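/- Let $d\ge 1$, $\Omega=\mathbb{R}^d$, $T\Omega=\mathbb{R}^d\times\mathbb{R}^d$ (points $(x,v)$), and let $\mu$ be a Borel probability measure on $\Omega$ with finite second moment. A \emph{measure field} over $\mu$ is a Borel probability measure $\xi$ on $T\Omega$ with finite second moment and first marginal $\pi_{x\#}\xi=\mu$; the set of these is $\mathscr{P}_2(T\Omega)_\mu$. For $\xi,\zeta\in\mathscr{P}_2(T\Omega)_\mu$ let $\Gamma_\mu(\xi,\zeta)$ be the set of probability measures $\alpha(dx,dv,dw)$ on $(\mathbb{R}^d)^3$ with finite second moment, $(\pi_x,\pi_v)_\#\alpha=\xi$ and $(\pi_x,\pi_w)_\#\alpha=\zeta$, and set $$W_\mu^2(\xi,\zeta)=\inf_{\alpha\in\Gamma_\mu(\xi,\zeta)}\int|v-w|^2\,d\alpha,\qquad \langle\xi,\zeta\rangle_\mu=\tfrac12\Big[\int|v|^2d\xi+\int|v|^2d\zeta-W_\mu^2(\xi,\zeta)\Big].$$ Let $W_{T\Omega}$ be the 2-Wasserstein distance on $T\Omega$ for the distance $\sqrt{|x-y|^2+|v-w|^2}$ between $(x,v)$ and $(y,w)$.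 A field $\xi$ is \emph{centred}, $\xi\in\mathscr{P}_2(T\Omega)^0_\mu$, if its barycenter is $0$, i.e. $\int\varphi\,d\xi=0$ for every continuous $\varphi:T\Omega\to\mathbb{R}$ of at most quadratic growth that is linear in $v$. Write $\lambda\cdot\xi=(\pi_x,\lambda\pi_v)_\#\xi$. A set $C\subset\mathscr{P}_2(T\Omega)_\mu$ is a \emph{cone} if $\lambda\cdot\xi\in C$ for all $\xi\in C$, $\lambda\ge0$; it is \emph{horizontally convex} if $(\pi_x,(1-\lambda)\pi_v+\lambda\pi_w)_\#\alpha\in C$ for all $\xi,\zeta\in C$, $\alpha\in\Gamma_\mu(\xi,\zeta)$, $\lambda\in[0,1]$. For a distance $W\in\{W_\mu,W_{T\Omega}\}$, $C$ is \emph{$W$-closed} if every $\xi\in\mathscr{P}_2(T\Omega)_\mu$ that is the $W$-limit of a sequence in $C$ belongs to $C$. Let $\mathrm{Tan}_\mu$ be the $W_\mu$-closure in $\mathscr{P}_2(T\Omega)_\mu$ of the set of all $\lambda\cdot\xi$ with $\lambda\ge0$, $\xi\in\mathscr{P}_2(T\Omega)_\mu$ and $(\pi_x,\pi_x+\pi_v)_\#\xi$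 an optimal transport plan between its marginals for the cost $|x-y|^2$; let $\mathrm{Sol}_\mu=\{\zeta\in\mathscr{P}_2(T\Omega)_\mu:\langle\xi,\zeta\rangle_\mu=0\ \forall\,\xi\in\mathrm{Tan}_\mu\}$; and let $\mathrm{Tan}^0_\mu$, $\mathrm{Sol}^0_\mu$ be their intersections with $\mathscr{P}_2(T\Omega)^0_\mu$. \textbf{Corollary.} Every $W_\mu$-closed, horizontally convex cone $C\subset\mathscr{P}_2(T\Omega)^0_\mu$ is $W_{T\Omega}$-closed: if $(\xi_n)_{n\in\mathbb{N}}\subset C$ converges with respect to $W_{T\Omega}$ to $\xi\in\mathscr{P}_2(T\Omega)_\mu$, then $\xi\in C$. In particular, $\mathrm{Tan}^0_\mu$ and $\mathrm{Sol}^0_\mu$ are $W_\mu$-closed, horizontally convex cones of centred fields, and hence are $W_{T\Omega}$-closed. -/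

import Mathlib

open MeasureTheory Filter Topology
open scoped ENNReal

noncomputable section

namespace MeasureField

/-- The base space `Ω = ℝᵈ`, with its Euclidean norm. -/
abbrev Space (d : ℕ) : Type := EuclideanSpace ℝ (Fin d)

/-- The tangent bundle `TΩ ≃ ℝᵈ × ℝᵈ`; a point is `(x, v)`. -/
abbrev TBundle (d : ℕ) : Type := Space d × Space d

/-- The bundle `T²Ω` of triples `(x, v, w)`, with `v`, `w` tangent at `x`. -/
abbrev T2Bundle (d : ℕ) : Type := Space d × Space d × Space d

/-- `μ ∈ 𝒫₂(X)`: a probability measure with finite second moment. (On a product, Mathlib's distance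
is the maximum of the two distances; it is equivalent to the Euclidean one, so finiteness of the
second moment is the same for both.) -/
structure IsP2 {X : Type*} [PseudoEMetricSpace X] [MeasurableSpace X] (μ : Measure X) : Prop where
  isProbabilityMeasure : IsProbabilityMeasure μ
  finite_moment : ∃ o : X, ∫⁻ x, edist x o ^ 2 ∂μ < ∞

/-! ### Optimal transport -/

/-- Transport plans `Γ(μ, ν)`. -/
def plans {X : Type*} [MeasurableSpace X] (μ ν : Measure X) : Set (Measure (X × X)) :=
  {α | α.map Prod.fst = μ ∧ α.map Prod.snd = ν}

/-- Infimum of `∫ c dα` over the transport plans `α` between `μ` and `ν`. -/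
def transportCost {X : Type*} [MeasurableSpace X] (c : X → X → ℝ≥0∞) (μ ν : Measure X) : ℝ≥0∞ :=
  ⨅ α ∈ plans μ ν, ∫⁻ p, c p.1 p.2 ∂α

variable {d : ℕ}

/-- The plan `η` on `Ω × Ω` is optimal between its marginals, for the cost `|x - y|²`. -/
def IsOptimalPlan (η : Measure (Space d × Space d)) : Prop :=
  ∫⁻ p, edist p.1 p.2 ^ 2 ∂η =
    transportCost (fun x y => edist x y ^ 2) (η.map Prod.fst) (η.map Prod.snd)

/-- The Wasserstein distance `W_{TΩ}` on the tangent bundle: the 2-Wasserstein distance for the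
distance `√(|x - y|² + |v - w|²)` between `(x, v)` and `(y, w)`. -/
def WTangent (ξ ζ : Measure (TBundle d)) : ℝ≥0∞ :=
  (transportCost (fun p q => edist p.1 q.1 ^ 2 + edist p.2 q.2 ^ 2) ξ ζ) ^ (1 / 2 : ℝ)

/-! ### Measure fields -/

/-- `𝒫₂(TΩ)_μ`: the measure fields over `μ`. -/
def fields (μ : Measure (Space d)) : Set (Measure (TBundle d)) :=
  {ξ | IsP2 ξ ∧ ξ.map Prod.fst = μ}

/-- `Γ_μ(ξ, ζ)`: the plans `α(dx, dv, dw)` on `T²Ω` with `(x, v)`-marginal `ξ` and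
`(x, w)`-marginal `ζ`. -/
def fieldPlans (ξ ζ : Measure (TBundle d)) : Set (Measure (T2Bundle d)) :=
  {α | IsP2 α ∧ α.map (fun p => (p.1, p.2.1)) = ξ ∧ α.map (fun p => (p.1, p.2.2)) = ζ}

/-- `W_μ(ξ, ζ)²`, for `ξ` and `ζ` with the same first marginal `μ`. -/
def WFiberSq (ξ ζ : Measure (TBundle d)) : ℝ≥0∞ :=
  ⨅ α ∈ fieldPlans ξ ζ, ∫⁻ p, edist p.2.1 p.2.2 ^ 2 ∂α

/-- The distance `W_μ`. -/
def WFiber (ξ ζ : Measure (TBundle d)) : ℝ≥0∞ := WFiberSq ξ ζ ^ (1 / 2 : ℝ)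

/-- `‖ξ‖_μ² = ∫ |v|² dξ`. -/
def normSq (ξ : Measure (TBundle d)) : ℝ := ∫ p, ‖p.2‖ ^ 2 ∂ξ

/-- The metric scalar product `⟨ξ, ζ⟩_μ`. -/
def metricInner (ξ ζ : Measure (TBundle d)) : ℝ :=
  (1 / 2) * (normSq ξ + normSq ζ - (WFiberSq ξ ζ).toReal)

/-- `b ∈ L²_μ` is the barycenter of `ξ`. -/
def IsBarycenter (μ : Measure (Space d)) (ξ : Measure (TBundle d)) (b : Space d → Space d) :
    Prop :=
  MemLp b 2 μ ∧
    ∀ φ : TBundle d → ℝ, Continuous φ →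
      (∃ K : ℝ, ∀ x v, |φ (x, v)| ≤ K * (1 + ‖x‖ ^ 2 + ‖v‖ ^ 2)) →
      (∀ x, IsLinearMap ℝ (fun v => φ (x, v))) →
      ∫ p, φ p ∂ξ = ∫ x, φ (x, b x) ∂μ

/-- `𝒫₂(TΩ)_μ⁰`: the centred measure fields, those with barycenter `0`. -/
def centredFields (μ : Measure (Space d)) : Set (Measure (TBundle d)) :=
  {ξ | ξ ∈ fields μ ∧ IsBarycenter μ ξ (fun _ => 0)}

/-- `r · ξ = (π_x, r π_v)_# ξ`. -/
def scale (r : ℝ) (ξ : Measure (TBundle d)) : Measure (TBundle d) :=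
  ξ.map (fun p => (p.1, r • p.2))

/-- (Positive) cones of measure fields. -/
def IsCone (C : Set (Measure (TBundle d))) : Prop :=
  ∀ ξ ∈ C, ∀ r : ℝ, 0 ≤ r → scale r ξ ∈ C

/-- Horizontal convexity: closed under interpolation along every plan of `Γ_μ`. -/
def IsHorizontallyConvex (C : Set (Measure (TBundle d))) : Prop :=
  ∀ ξ ∈ C, ∀ ζ ∈ C, ∀ α ∈ fieldPlans ξ ζ, ∀ t ∈ Set.Icc (0 : ℝ) 1,
    α.map (fun p => (p.1, (1 - t) • p.2.1 + t • p.2.2)) ∈ C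

/-- `C` is closed in `𝒫₂(TΩ)_μ` with respect to the distance `W`: it contains the limits in
`𝒫₂(TΩ)_μ` of its sequences. -/
def IsClosedFor (W : Measure (TBundle d) → Measure (TBundle d) → ℝ≥0∞) (μ : Measure (Space d))
    (C : Set (Measure (TBundle d))) : Prop :=
  ∀ u : ℕ → Measure (TBundle d), (∀ n, u n ∈ C) →
    ∀ ξ ∈ fields μ, Tendsto (fun n => W (u n) ξ) atTop (𝓝 0) → ξ ∈ C

/-- `W_μ`-closed, horizontally convex cones of centred measure fields. -/
structure IsClosedConvexCentredCone (μ : Measure (Space d)) (C : Set (Measure (TBundle d))) :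
    Prop where
  centred : C ⊆ centredFields μ
  closed : IsClosedFor WFiber μ C
  convex : IsHorizontallyConvex C
  cone : IsCone C

/-! ### Tangent and solenoidal measure fields -/

/-- The fields `r · ξ` with `r ≥ 0`, `ξ ∈ 𝒫₂(TΩ)_μ` and `(π_x, π_x + π_v)_# ξ` optimal between its
marginals. -/
def geodesicCone (μ : Measure (Space d)) : Set (Measure (TBundle d)) :=
  {ζ | ∃ r : ℝ, 0 ≤ r ∧ ∃ ξ ∈ fields μ,
    IsOptimalPlan (ξ.map (fun p => (p.1, p.1 + p.2))) ∧ ζ = scale r ξ}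

/-- The geometric tangent cone `Tan_μ`: the `W_μ`-closure of `geodesicCone μ`. -/
def Tan (μ : Measure (Space d)) : Set (Measure (TBundle d)) :=
  {ξ | ξ ∈ fields μ ∧ ∃ u : ℕ → Measure (TBundle d),
    (∀ n, u n ∈ geodesicCone μ) ∧ Tendsto (fun n => WFiber (u n) ξ) atTop (𝓝 0)}

/-- The solenoidal cone `Sol_μ`: the metric orthogonal of `Tan_μ`. -/
def Sol (μ : Measure (Space d)) : Set (Measure (TBundle d)) :=
  {ζ | ζ ∈ fields μ ∧ ∀ ξ ∈ Tan μ, metricInner ξ ζ = 0}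

/-- `Tan_μ⁰`. -/
def Tan0 (μ : Measure (Space d)) : Set (Measure (TBundle d)) := Tan μ ∩ centredFields μ

/-- `Sol_μ⁰`. -/
def Sol0 (μ : Measure (Space d)) : Set (Measure (TBundle d)) := Sol μ ∩ centredFields μ

end MeasureField

end

/-!
Measure fields over `μ` are handled as random fields: measurable maps `(π, f)` on a probability
space with `π` of law `μ` and `f ∈ L²`. A plan in `fieldPlans` is a pair of random fields on one
probability space, horizontal interpolation is convex combination of random variables, and the
distance `W_μ` is bounded by the `L²` distance. Plans are composed by `exists_glue`.

**Closed cones are `W_{TΩ}`-closed** (`isClosedFor_WTangent_of_cone`). Let `C` be a `W_μ`-closed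
horizontally convex cone of centred fields. The point is that membership in `C` is a pointwise
linear constraint: a centred field `ξ` belongs to `C` as soon as `⟪v, w(x)⟫ = 0` holds `ξ`-a.e. for
every `w ∈ L²_μ` such that `⟪v, w(x)⟫ = 0` holds `ζ`-a.e. for all `ζ ∈ C`. These constraints pass to
`W_{TΩ}`-limits, since `w` can be approximated in `L²_μ` by smooth compactly supported maps
(`ae_inner_eq_zero_of_limit`), and so does centredness (`isClosedFor_WTangent_centredFields`).

The implication rests on two properties of `C`.
* `C` is stable under conditional expectations (`map_integral_mem`): averages of `2 ^ n`
  conditionally independent copies stay in `C` and converge in `W_μ` to the conditional mean.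
* If `μ ⊗ η ∈ C`, `μ ⊗ κ` is any field, `b(x) = ∫ θ(x, w) w dη_x(w)` and `k(x, v)` is bounded with
  zero `κ_x`-mean, then `(x, k(x, v) b(x))` has its law in `C` (`map_smul_mem`). Indeed it is a
  conditional mean for the coupling of `κ_x` and `η_x` of density
  `1 + k(x, v) (θ(x, w) - ∫ θ(x, ·) dη_x)`, in which centredness removes the term without `k`.

If `ξ = μ ⊗ κ` were not in `C`, the closed convex cone of those `g ∈ L²(ξ)` with law in `C` would be
separated from `(x, v) ↦ v` by some `h ∈ L²(ξ)` (`exists_separating`), and the fibrewise mean of `h`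
can be removed because all the fields are centred. Testing `h` against `± k b` shows that `h` is
fibrewise orthogonal to every `b(x)`. Hence every fibrewise partial mean `w` of `h` is orthogonal to
all members of `C`, so it is orthogonal to `ξ`, and then `⟪v, h(x, v)⟫ = 0` holds `ξ`-a.e.,
a contradiction.

**The tangent cone.** A coupling `(X, Y)` is optimal if and only if `E⟪X' - X, Y⟫ ≤ 0` for all
variables `X'` with the law of `X`, on any extension of the probability space. This is linear in
`Y`, so optimality of `(x, x + f)` is stable under convex combinations of the displacements `f`
(`isOptimalPlan_combination`); cyclical monotonicity is not needed. By gluing, horizontal convexity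
passes to the `W_μ`-closure.

**The solenoidal cone.** For a centred field `ζ`, the coupling with `ξ` that is independent over
each base point gives `⟨ξ, ζ⟩_μ ≥ 0`. So `ζ ∈ Sol_μ` amounts to `∫ ⟪v, w⟫ dα ≤ 0` for all
`ξ ∈ Tan_μ` and all `α ∈ Γ_μ(ξ, ζ)` (`mem_Sol0_iff`), a condition which is conic,
horizontally convex and closed.
-/

noncomputable section

namespace MeasureField

open ProbabilityTheory

variable {d : ℕ}

/-! ### Random fields -/

section Basic

variable {Z : Type*} [MeasurableSpace Z] {ν : Measure Z}

lemma memLp_two_iff_lintegral {F : Type*} [NormedAddCommGroup F] {f : Z → F}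
    (hf : AEStronglyMeasurable f ν) : MemLp f 2 ν ↔ ∫⁻ z, ‖f z‖ₑ ^ 2 ∂ν < ∞ := by
  have h := eLpNorm_lt_top_iff_lintegral_rpow_enorm_lt_top (μ := ν) (f := f) (p := 2)
    (by norm_num) (by norm_num)
  simp only [ENNReal.toReal_ofNat, ENNReal.rpow_ofNat] at h
  rw [← h]
  exact ⟨fun h => h.2, fun h => ⟨hf, h⟩⟩

lemma isP2_iff {X : Type*} [NormedAddCommGroup X] [MeasurableSpace X] [BorelSpace X]
    [SecondCountableTopology X] {μ : Measure X} :
    IsP2 μ ↔ IsProbabilityMeasure μ ∧ MemLp id 2 μ := by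
  constructor
  · rintro ⟨h, o, ho⟩
    refine ⟨h, ?_⟩
    have h1 : MemLp (fun x : X => x - o) 2 μ := by
      rw [memLp_two_iff_lintegral (by fun_prop)]
      simpa [edist_eq_enorm_sub] using ho
    have h2 := h1.add (memLp_const o)
    convert h2 using 1
    ext x
    simp
  · rintro ⟨h, h2⟩
    refine ⟨h, 0, ?_⟩
    rw [memLp_two_iff_lintegral (by fun_prop)] at h2
    simpa [edist_eq_enorm_sub] using h2

lemma isP2_map_iff {X : Type*} [NormedAddCommGroup X] [MeasurableSpace X] [BorelSpace X]
    [SecondCountableTopology X] [IsProbabilityMeasure ν] {F : Z → X} (hF : Measurable F) :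
    IsP2 (ν.map F) ↔ MemLp F 2 ν := by
  rw [isP2_iff, memLp_map_measure_iff (by fun_prop) hF.aemeasurable]
  exact ⟨fun h => h.2, fun h => ⟨Measure.isProbabilityMeasure_map hF.aemeasurable, h⟩⟩

lemma mem_fields_iff {μ : Measure (Space d)} {ξ : Measure (TBundle d)} :
    ξ ∈ fields μ ↔ IsProbabilityMeasure ξ ∧ MemLp Prod.fst 2 ξ ∧ MemLp Prod.snd 2 ξ ∧
      ξ.map Prod.fst = μ := by
  have : MemLp id 2 ξ ↔ MemLp Prod.fst 2 ξ ∧ MemLp Prod.snd 2 ξ := memLp_prod_iff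
  rw [fields, Set.mem_ofPred_eq, isP2_iff, this, and_assoc, and_assoc]

lemma mem_fieldPlans_iff {ξ ζ : Measure (TBundle d)} {α : Measure (T2Bundle d)} :
    α ∈ fieldPlans ξ ζ ↔ IsProbabilityMeasure α ∧ MemLp Prod.fst 2 α ∧
      MemLp (fun p => p.2.1) 2 α ∧ MemLp (fun p => p.2.2) 2 α ∧
      α.map (fun p => (p.1, p.2.1)) = ξ ∧ α.map (fun p => (p.1, p.2.2)) = ζ := by
  have h1 : MemLp id 2 α ↔ MemLp Prod.fst 2 α ∧ MemLp Prod.snd 2 α := memLp_prod_iff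
  have h2 : MemLp Prod.snd 2 α ↔ MemLp (fun p => p.2.1) 2 α ∧ MemLp (fun p => p.2.2) 2 α :=
    memLp_prod_iff
  rw [fieldPlans, Set.mem_ofPred_eq, isP2_iff, h1, h2]
  tauto

lemma map_mem_fields [IsProbabilityMeasure ν] {π f : Z → Space d} (hπ : Measurable π)
    (hf : Measurable f) (hπ2 : MemLp π 2 ν) (hf2 : MemLp f 2 ν) :
    ν.map (fun z => (π z, f z)) ∈ fields (ν.map π) := by
  refine ⟨(isP2_map_iff (by fun_prop)).2 (memLp_prod_iff.2 ⟨hπ2, hf2⟩), ?_⟩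
  rw [Measure.map_map (by fun_prop) (by fun_prop)]
  rfl

lemma map_mem_fieldPlans [IsProbabilityMeasure ν] {π f g : Z → Space d} (hπ : Measurable π)
    (hf : Measurable f) (hg : Measurable g) (hπ2 : MemLp π 2 ν) (hf2 : MemLp f 2 ν)
    (hg2 : MemLp g 2 ν) :
    ν.map (fun z => (π z, f z, g z)) ∈
      fieldPlans (ν.map (fun z => (π z, f z))) (ν.map (fun z => (π z, g z))) := by
  refine ⟨(isP2_map_iff (by fun_prop)).2 (memLp_prod_iff.2 ⟨hπ2, memLp_prod_iff.2 ⟨hf2, hg2⟩⟩),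
    ?_, ?_⟩ <;>
  · rw [Measure.map_map (by fun_prop) (by fun_prop)]
    rfl

/-- Two random fields carried by the same probability space are at distance at most their `L²`
distance. -/
lemma WFiberSq_map_le [IsProbabilityMeasure ν] {π f g : Z → Space d} (hπ : Measurable π)
    (hf : Measurable f) (hg : Measurable g) (hπ2 : MemLp π 2 ν) (hf2 : MemLp f 2 ν)
    (hg2 : MemLp g 2 ν) :
    WFiberSq (ν.map (fun z => (π z, f z))) (ν.map (fun z => (π z, g z))) ≤
      ∫⁻ z, ‖f z - g z‖ₑ ^ 2 ∂ν := by
  refine (iInf₂_le _ (map_mem_fieldPlans hπ hf hg hπ2 hf2 hg2)).trans ?_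
  rw [lintegral_map (by fun_prop) (by fun_prop)]
  simp [edist_eq_enorm_sub]

/-- Horizontal convexity, for random fields carried by the same probability space. -/
lemma IsHorizontallyConvex.map_mem {C : Set (Measure (TBundle d))} (hC : IsHorizontallyConvex C)
    [IsProbabilityMeasure ν] {π f g : Z → Space d} (hπ : Measurable π)
    (hf : Measurable f) (hg : Measurable g) (hπ2 : MemLp π 2 ν) (hf2 : MemLp f 2 ν)
    (hg2 : MemLp g 2 ν) (hfC : ν.map (fun z => (π z, f z)) ∈ C)
    (hgC : ν.map (fun z => (π z, g z)) ∈ C) {t : ℝ} (ht : t ∈ Set.Icc (0 : ℝ) 1) :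
    ν.map (fun z => (π z, (1 - t) • f z + t • g z)) ∈ C := by
  have := hC _ hfC _ hgC _ (map_mem_fieldPlans hπ hf hg hπ2 hf2 hg2) t ht
  rw [Measure.map_map (by fun_prop) (by fun_prop)] at this
  exact this

lemma IsCone.map_mem {C : Set (Measure (TBundle d))} (hC : IsCone C)
    {π f : Z → Space d} (hπ : Measurable π) (hf : Measurable f)
    (hfC : ν.map (fun z => (π z, f z)) ∈ C) {r : ℝ} (hr : 0 ≤ r) :
    ν.map (fun z => (π z, r • f z)) ∈ C := by
  have := hC _ hfC r hr
  rw [scale, Measure.map_map (by fun_prop) (by fun_prop)] at this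
  exact this

end Basic

/-- Gluing: two probability measures with a common image can be coupled over that image. -/
lemma exists_glue {X Y W : Type*} [MeasurableSpace X] [MeasurableEq X]
    [MeasurableSpace Y] [MeasurableSpace W] [StandardBorelSpace W]
    {α : Measure Y} {β : Measure W} [IsProbabilityMeasure α] [IsProbabilityMeasure β]
    {f : Y → X} {g : W → X} (hf : Measurable f) (hg : Measurable g) (h : α.map f = β.map g) :
    ∃ γ : Measure (Y × W), IsProbabilityMeasure γ ∧ γ.map Prod.fst = α ∧ γ.map Prod.snd = β ∧
      ∀ᵐ p ∂γ, f p.1 = g p.2 := by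
  have : Nonempty W := β.nonempty_of_neZero
  let β' : Measure (X × W) := β.map (fun w => (g w, w))
  have : IsProbabilityMeasure β' := Measure.isProbabilityMeasure_map (by fun_prop)
  let γ : Measure (Y × W) := α ⊗ₘ (β'.condKernel.comap f hf)
  have hβ' : β'.fst = α.map f := by
    rw [h, Measure.fst, Measure.map_map (by fun_prop) (by fun_prop)]
    rfl
  have hγ : γ.map (fun p => (f p.1, p.2)) = β' := by
    ext s hs
    rw [Measure.map_apply (by fun_prop) hs, Measure.compProd_apply
      (hs.preimage (by fun_prop : Measurable fun p : Y × W => (f p.1, p.2)))]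
    conv_rhs => rw [← β'.disintegrate β'.condKernel, Measure.compProd_apply hs, hβ',
      lintegral_map (Kernel.measurable_kernel_prodMk_left hs) hf]
    rfl
  refine ⟨γ, inferInstance, ?_, ?_, ?_⟩
  · exact Measure.fst_compProd _ _
  · have : γ.map Prod.snd = (γ.map (fun p => (f p.1, p.2))).map Prod.snd := by
      rw [Measure.map_map (by fun_prop) (by fun_prop)]
      rfl
    rw [this, hγ, Measure.map_map (by fun_prop) (by fun_prop)]
    exact Measure.map_id
  · have hm : MeasurableSet {q : X × W | q.1 = g q.2} :=
      measurableSet_eq_fun measurable_fst (by fun_prop)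
    have : ∀ᵐ q ∂β', q.1 = g q.2 := by
      rw [ae_map_iff (by fun_prop) hm]
      simp
    rw [← hγ, ae_map_iff (by fun_prop) hm] at this
    exact this

/-! ### Sequential closedness and approximation -/

section Closedness

lemma exists_seq_tendsto_sqrt_iff {β : Type*} {S : Set β} {c : β → ℝ≥0∞} :
    (∃ u : ℕ → β, (∀ n, u n ∈ S) ∧ Tendsto (fun n => c (u n) ^ (1 / 2 : ℝ)) atTop (𝓝 0)) ↔
      ∀ ε : ℝ≥0∞, ε ≠ 0 → ∃ u ∈ S, c u < ε := by
  constructor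
  · rintro ⟨u, hu, hlim⟩ ε hε
    have h2 : Tendsto (fun n => c (u n)) atTop (𝓝 0) := by
      have h := hlim.ennrpow_const 2
      rw [ENNReal.zero_rpow_of_pos two_pos] at h
      refine h.congr fun n => ?_
      rw [← ENNReal.rpow_mul]
      norm_num
    obtain ⟨n, hn⟩ := (h2.eventually_lt_const (pos_iff_ne_zero.2 hε)).exists
    exact ⟨u n, hu n, hn⟩
  · intro h
    choose u hu hc using h
    have h0 : ∀ n : ℕ, (n : ℝ≥0∞)⁻¹ ≠ 0 := fun n => by simp
    refine ⟨fun n => u _ (h0 n), fun n => hu _ _, ?_⟩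
    have h2 : Tendsto (fun n : ℕ => c (u _ (h0 n))) atTop (𝓝 0) :=
      tendsto_of_tendsto_of_tendsto_of_le_of_le tendsto_const_nhds
        ENNReal.tendsto_inv_nat_nhds_zero (fun _ => zero_le) (fun n => (hc _ _).le)
    simpa using h2.ennrpow_const (1 / 2)

lemma isClosedFor_WFiber_iff {μ : Measure (Space d)} {C : Set (Measure (TBundle d))} :
    IsClosedFor WFiber μ C ↔ ∀ ξ ∈ fields μ,
      (∀ ε : ℝ≥0∞, ε ≠ 0 → ∃ u ∈ C, WFiberSq u ξ < ε) → ξ ∈ C := by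
  simp only [← exists_seq_tendsto_sqrt_iff]
  exact ⟨fun h ξ hξ ⟨u, hu, hl⟩ => h u hu ξ hξ hl, fun h u hu ξ hξ hl => h ξ hξ ⟨u, hu, hl⟩⟩

lemma isClosedFor_WTangent_iff {μ : Measure (Space d)} {C : Set (Measure (TBundle d))} :
    IsClosedFor WTangent μ C ↔ ∀ ξ ∈ fields μ,
      (∀ ε : ℝ≥0∞, ε ≠ 0 → ∃ u ∈ C, ∃ γ ∈ plans u ξ,
        ∫⁻ p, (edist p.1.1 p.2.1 ^ 2 + edist p.1.2 p.2.2 ^ 2) ∂γ < ε) → ξ ∈ C := by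
  have : ∀ (u ξ : Measure (TBundle d)) (ε : ℝ≥0∞), (∃ γ ∈ plans u ξ,
        ∫⁻ p, (edist p.1.1 p.2.1 ^ 2 + edist p.1.2 p.2.2 ^ 2) ∂γ < ε) ↔
      transportCost (fun p q => edist p.1 q.1 ^ 2 + edist p.2 q.2 ^ 2) u ξ < ε := by
    intro u ξ ε
    simp [transportCost, iInf_lt_iff]
  simp only [this, ← exists_seq_tendsto_sqrt_iff]
  exact ⟨fun h ξ hξ ⟨u, hu, hl⟩ => h u hu ξ hξ hl, fun h u hu ξ hξ hl => h ξ hξ ⟨u, hu, hl⟩⟩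

lemma mem_Tan_iff {μ : Measure (Space d)} {ξ : Measure (TBundle d)} :
    ξ ∈ Tan μ ↔ ξ ∈ fields μ ∧ ∀ ε : ℝ≥0∞, ε ≠ 0 → ∃ u ∈ geodesicCone μ, WFiberSq u ξ < ε := by
  rw [← exists_seq_tendsto_sqrt_iff]
  rfl

lemma WFiberSq_lt_iff {ξ ζ : Measure (TBundle d)} {ε : ℝ≥0∞} :
    WFiberSq ξ ζ < ε ↔ ∃ α ∈ fieldPlans ξ ζ, ∫⁻ p, edist p.2.1 p.2.2 ^ 2 ∂α < ε := by
  simp [WFiberSq, iInf_lt_iff]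

end Closedness

/-! ### Averages of independent copies -/

section Moments

lemma lintegral_enorm_sq_eq {Z F : Type*} [MeasurableSpace Z] {ν : Measure Z}
    [NormedAddCommGroup F] {f : Z → F} (hf : MemLp f 2 ν) :
    ∫⁻ z, ‖f z‖ₑ ^ 2 ∂ν = ENNReal.ofReal (∫ z, ‖f z‖ ^ 2 ∂ν) := by
  rw [ofReal_integral_eq_lintegral_ofReal
    ((memLp_two_iff_integrable_sq_norm hf.aestronglyMeasurable).1 hf)
    (ae_of_all _ fun z => by positivity)]
  refine lintegral_congr fun z => ?_
  rw [ENNReal.ofReal_pow (norm_nonneg _), ofReal_norm]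

lemma eLpNorm_two_sq {Z F : Type*} [MeasurableSpace Z] {ν : Measure Z}
    [NormedAddCommGroup F] {f : Z → F} : eLpNorm f 2 ν ^ 2 = ∫⁻ z, ‖f z‖ₑ ^ 2 ∂ν := by
  rw [eLpNorm_eq_lintegral_rpow_enorm_toReal (by norm_num) (by norm_num),
    ← ENNReal.rpow_natCast, ← ENNReal.rpow_mul]
  simp

lemma enorm_integral_sq_le {Z F : Type*} [MeasurableSpace Z] {ν : Measure Z}
    [IsProbabilityMeasure ν] [NormedAddCommGroup F] [NormedSpace ℝ F] {f : Z → F}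
    (hf : AEStronglyMeasurable f ν) : ‖∫ z, f z ∂ν‖ₑ ^ 2 ≤ ∫⁻ z, ‖f z‖ₑ ^ 2 ∂ν := by
  have h1 : ‖∫ z, f z ∂ν‖ₑ ≤ eLpNorm f 1 ν := by
    rw [eLpNorm_one_eq_lintegral_enorm]
    exact enorm_integral_le_lintegral_enorm f
  have h2 := h1.trans (eLpNorm_le_eLpNorm_of_exponent_le one_le_two hf)
  rw [← eLpNorm_two_sq]
  gcongr

lemma integrable_inner_of_memLp {Z F : Type*} [MeasurableSpace Z] {ν : Measure Z}
    [NormedAddCommGroup F] [InnerProductSpace ℝ F] {f g : Z → F} (hf : MemLp f 2 ν)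
    (hg : MemLp g 2 ν) : Integrable (fun z => inner ℝ (f z) (g z)) ν := by
  refine (hf.norm.integrable_mul hg.norm).mono
    (hf.aestronglyMeasurable.inner hg.aestronglyMeasurable) (ae_of_all _ fun z => ?_)
  simpa using norm_inner_le_norm (𝕜 := ℝ) (f z) (g z)

variable {E : Type*} [NormedAddCommGroup E] [InnerProductSpace ℝ E] [CompleteSpace E]
  [MeasurableSpace E]

/-- Averaging two independent copies halves the variance. -/
lemma lintegral_prod_average (ρ : Measure E) [IsProbabilityMeasure ρ] (h : MemLp id 2 ρ) :
    ∫⁻ p, ‖(1 - 2⁻¹ : ℝ) • p.1 + (2⁻¹ : ℝ) • p.2 - ∫ w, w ∂ρ‖ₑ ^ 2 ∂(ρ.prod ρ) =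
      2⁻¹ * ∫⁻ w, ‖w - ∫ w, w ∂ρ‖ₑ ^ 2 ∂ρ := by
  set m := ∫ w, w ∂ρ with hm
  have hX : MemLp (fun w => w - m) 2 ρ := h.sub (memLp_const m)
  have hX1 : MemLp (fun p : E × E => p.1 - m) 2 (ρ.prod ρ) := hX.comp_fst ρ
  have hX2 : MemLp (fun p : E × E => p.2 - m) 2 (ρ.prod ρ) := hX.comp_snd ρ
  have hi : Integrable (fun w => w - m) ρ := hX.integrable one_le_two
  have h0 : ∫ w, (w - m) ∂ρ = 0 := by
    rw [integral_sub (f := fun w => w) (h.integrable one_le_two) (integrable_const _)]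
    simp [hm]
  have hcross : ∫ p : E × E, inner ℝ (p.1 - m) (p.2 - m) ∂(ρ.prod ρ) = 0 := by
    rw [integral_prod _ (integrable_inner_of_memLp hX1 hX2)]
    have : ∀ x : E, ∫ y, inner ℝ (x - m) (y - m) ∂ρ = 0 := fun x => by
      rw [integral_inner hi, h0, inner_zero_right]
    simp [this]
  have hs : Integrable (fun w => ‖w - m‖ ^ 2) ρ :=
    (memLp_two_iff_integrable_sq_norm hX.aestronglyMeasurable).1 hX
  have hs1 := (memLp_two_iff_integrable_sq_norm hX1.aestronglyMeasurable).1 hX1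
  have hs2 := (memLp_two_iff_integrable_sq_norm hX2.aestronglyMeasurable).1 hX2
  have hY : MemLp (fun p : E × E => (1 - 2⁻¹ : ℝ) • p.1 + (2⁻¹ : ℝ) • p.2 - m) 2
      (ρ.prod ρ) := by
    convert! (hX1.const_smul (1 - 2⁻¹ : ℝ)).add (hX2.const_smul (2⁻¹ : ℝ)) using 1
    ext p
    simp only [Pi.add_apply, Pi.smul_apply]
    module
  rw [lintegral_enorm_sq_eq hY, lintegral_enorm_sq_eq hX]
  have hexp : ∀ p : E × E, ‖(1 - 2⁻¹ : ℝ) • p.1 + (2⁻¹ : ℝ) • p.2 - m‖ ^ 2 =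
      4⁻¹ * ‖p.1 - m‖ ^ 2 + 4⁻¹ * ‖p.2 - m‖ ^ 2 + 2⁻¹ * inner ℝ (p.1 - m) (p.2 - m) := by
    intro p
    have : (1 - 2⁻¹ : ℝ) • p.1 + (2⁻¹ : ℝ) • p.2 - m =
        (2⁻¹ : ℝ) • (p.1 - m) + (2⁻¹ : ℝ) • (p.2 - m) := by module
    rw [this, norm_add_sq_real, norm_smul, norm_smul, inner_smul_left, inner_smul_right]
    norm_num
    ring
  simp_rw [hexp]
  have hi1 := hs1.const_mul 4⁻¹
  have hi2 := hs2.const_mul 4⁻¹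
  have hi12 : Integrable (fun p : E × E => 4⁻¹ * ‖p.1 - m‖ ^ 2 + 4⁻¹ * ‖p.2 - m‖ ^ 2)
      (ρ.prod ρ) := hi1.add hi2
  rw [integral_add hi12 ((integrable_inner_of_memLp hX1 hX2).const_mul _), integral_add hi1 hi2,
    integral_const_mul, integral_const_mul, integral_const_mul, hcross,
    integral_fun_fst (fun w => ‖w - m‖ ^ 2), integral_fun_snd (fun w => ‖w - m‖ ^ 2)]
  have h2 : (2⁻¹ : ℝ≥0∞) = ENNReal.ofReal 2⁻¹ := by
    rw [ENNReal.ofReal_inv_of_pos two_pos]; simp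
  rw [h2, ← ENNReal.ofReal_mul (by norm_num)]
  congr 1
  simp
  ring

end Moments

/-! ### Stability under conditional expectation -/

section Averaging

lemma memLp_comp_map_iff {Z Y F : Type*} [MeasurableSpace Z] {ν : Measure Z}
    [MeasurableSpace Y] [NormedAddCommGroup F]
    {g : Z → Y} (hg : Measurable g) {f : Y → F} (hf : StronglyMeasurable f) :
    MemLp f 2 (ν.map g) ↔ MemLp (fun z => f (g z)) 2 ν :=
  memLp_map_measure_iff hf.aestronglyMeasurable hg.aemeasurable

variable {Z : Type*} [MeasurableSpace Z] {ν : Measure Z} [IsProbabilityMeasure ν]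

lemma memLp_snd_compProd_iff {τ : Kernel Z (Space d)} [IsMarkovKernel τ] :
    MemLp Prod.snd 2 (ν ⊗ₘ τ) ↔ ∫⁻ z, ∫⁻ w, ‖w‖ₑ ^ 2 ∂τ z ∂ν < ∞ := by
  rw [memLp_two_iff_lintegral (by fun_prop), Measure.lintegral_compProd (by fun_prop)]

lemma ae_memLp_of_compProd {τ : Kernel Z (Space d)} [IsMarkovKernel τ]
    (h : MemLp Prod.snd 2 (ν ⊗ₘ τ)) : ∀ᵐ z ∂ν, MemLp id 2 (τ z) := by
  have h' := memLp_snd_compProd_iff.1 h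
  filter_upwards [ae_lt_top (by fun_prop) h'.ne] with z hz
  rwa [memLp_two_iff_lintegral (by fun_prop)]

lemma measurable_integral_kernel (τ : Kernel Z (Space d)) [IsMarkovKernel τ] :
    Measurable fun z => ∫ w, w ∂τ z :=
  (StronglyMeasurable.integral_kernel (f := fun w : Space d => w) (by fun_prop)).measurable

lemma memLp_integral_kernel {τ : Kernel Z (Space d)} [IsMarkovKernel τ]
    (h : MemLp Prod.snd 2 (ν ⊗ₘ τ)) : MemLp (fun z => ∫ w, w ∂τ z) 2 ν := by
  rw [memLp_two_iff_lintegral (measurable_integral_kernel τ).aestronglyMeasurable]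
  exact (lintegral_mono fun z => enorm_integral_sq_le (by fun_prop)).trans_lt
    (memLp_snd_compProd_iff.1 h)

/-- The kernel of the average of two independent copies. -/
def averageKernel (τ : Kernel Z (Space d)) : Kernel Z (Space d) :=
  (τ ×ₖ τ).map (fun p => (1 - 2⁻¹ : ℝ) • p.1 + (2⁻¹ : ℝ) • p.2)

lemma compProd_averageKernel {τ : Kernel Z (Space d)} : ν ⊗ₘ averageKernel τ = (ν ⊗ₘ (τ ×ₖ τ)).map
    (fun p => (p.1, (1 - 2⁻¹ : ℝ) • p.2.1 + (2⁻¹ : ℝ) • p.2.2)) := by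
  rw [averageKernel, Measure.compProd_map (by fun_prop)]
  rfl

lemma map_fst_compProd_prod (κ η : Kernel Z (Space d)) [IsMarkovKernel κ] [IsMarkovKernel η] :
    (ν ⊗ₘ (κ ×ₖ η)).map (fun p => (p.1, p.2.1)) = ν ⊗ₘ κ := by
  have := Measure.compProd_map (μ := ν) (κ := κ ×ₖ η) (f := Prod.fst) measurable_fst
  rw [← Kernel.fst_eq, Kernel.fst_prod] at this
  rw [this]
  rfl

lemma map_snd_compProd_prod (κ η : Kernel Z (Space d)) [IsMarkovKernel κ] [IsMarkovKernel η] :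
    (ν ⊗ₘ (κ ×ₖ η)).map (fun p => (p.1, p.2.2)) = ν ⊗ₘ η := by
  have := Measure.compProd_map (μ := ν) (κ := κ ×ₖ η) (f := Prod.snd) measurable_snd
  rw [← Kernel.snd_eq, Kernel.snd_prod] at this
  rw [this]
  rfl

variable {τ : Kernel Z (Space d)} [IsMarkovKernel τ]

instance : IsMarkovKernel (averageKernel τ) :=
  Kernel.IsMarkovKernel.map _ (by fun_prop)

lemma memLp_average (h : MemLp Prod.snd 2 (ν ⊗ₘ τ)) :
    MemLp (fun p : Z × Space d × Space d => p.2.1) 2 (ν ⊗ₘ (τ ×ₖ τ)) ∧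
    MemLp (fun p : Z × Space d × Space d => p.2.2) 2 (ν ⊗ₘ (τ ×ₖ τ)) ∧
    MemLp Prod.snd 2 (ν ⊗ₘ averageKernel τ) := by
  have h1 : MemLp (fun p : Z × Space d × Space d => p.2.1) 2 (ν ⊗ₘ (τ ×ₖ τ)) := by
    rw [← map_fst_compProd_prod τ τ,
      memLp_comp_map_iff (by fun_prop) measurable_snd.stronglyMeasurable] at h
    exact h
  have h2 : MemLp (fun p : Z × Space d × Space d => p.2.2) 2 (ν ⊗ₘ (τ ×ₖ τ)) := by
    rw [← map_snd_compProd_prod τ τ,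
      memLp_comp_map_iff (by fun_prop) measurable_snd.stronglyMeasurable] at h
    exact h
  refine ⟨h1, h2, ?_⟩
  rw [compProd_averageKernel, memLp_comp_map_iff (by fun_prop) measurable_snd.stronglyMeasurable]
  exact (h1.const_smul (1 - 2⁻¹ : ℝ)).add (h2.const_smul (2⁻¹ : ℝ))

lemma averageKernel_map_mem {C : Set (Measure (TBundle d))} (hcv : IsHorizontallyConvex C)
    {π : Z → Space d} (hπ : Measurable π) (hπ2 : MemLp π 2 ν)
    (h2 : MemLp Prod.snd 2 (ν ⊗ₘ τ)) (hC : (ν ⊗ₘ τ).map (fun p => (π p.1, p.2)) ∈ C) :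
    (ν ⊗ₘ averageKernel τ).map (fun p => (π p.1, p.2)) ∈ C := by
  obtain ⟨h21, h22, -⟩ := memLp_average h2
  have hπ' : MemLp (fun p : Z × Space d × Space d => π p.1) 2 (ν ⊗ₘ (τ ×ₖ τ)) := by
    have : ν = (ν ⊗ₘ (τ ×ₖ τ)).map Prod.fst := (Measure.fst_compProd _ _).symm
    rw [this, memLp_comp_map_iff (by fun_prop) hπ.stronglyMeasurable] at hπ2
    exact hπ2
  rw [compProd_averageKernel, Measure.map_map (by fun_prop) (by fun_prop)]
  refine hcv.map_mem (π := fun p : Z × Space d × Space d => π p.1) (f := fun p => p.2.1)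
    (g := fun p => p.2.2) (by fun_prop) (by fun_prop) (by fun_prop) hπ' h21 h22 ?_ ?_
    ⟨by norm_num, by norm_num⟩
  · rw [← map_fst_compProd_prod τ τ, Measure.map_map (by fun_prop) (by fun_prop)] at hC
    exact hC
  · rw [← map_snd_compProd_prod τ τ, Measure.map_map (by fun_prop) (by fun_prop)] at hC
    exact hC

lemma integral_averageKernel {z : Z} (h : MemLp id 2 (τ z)) :
    ∫ w, w ∂averageKernel τ z = ∫ w, w ∂τ z := by
  have hi : Integrable (fun w => w) (τ z) := h.integrable one_le_two
  have h1 := (hi.comp_fst (τ z)).smul (1 - 2⁻¹ : ℝ)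
  have h2 := (hi.comp_snd (τ z)).smul (2⁻¹ : ℝ)
  simp only [Pi.smul_def] at h1 h2
  rw [averageKernel, Kernel.map_apply _ (by fun_prop), integral_map (by fun_prop) (by fun_prop),
    Kernel.prod_apply, integral_add h1 h2,
    integral_smul, integral_smul, integral_fun_fst (fun w => w), integral_fun_snd (fun w => w)]
  simp only [probReal_univ, one_smul]
  module

lemma variance_averageKernel {z : Z} (h : MemLp id 2 (τ z)) :
    ∫⁻ w, ‖w - ∫ w, w ∂τ z‖ₑ ^ 2 ∂averageKernel τ z =
      2⁻¹ * ∫⁻ w, ‖w - ∫ w, w ∂τ z‖ₑ ^ 2 ∂τ z := by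
  rw [averageKernel, Kernel.map_apply _ (by fun_prop), lintegral_map (by fun_prop) (by fun_prop),
    Kernel.prod_apply, lintegral_prod_average _ h]

/-- A closed horizontally convex set is stable under conditional expectation: replacing a random
field by its mean given `z`, where `z` determines the base point, does not leave the set. The
mean is the limit of averages of `2 ^ n` conditionally independent copies, and each such average
is reached by `n` horizontal interpolations. -/
lemma map_integral_mem {μ : Measure (Space d)} {C : Set (Measure (TBundle d))}
    (hcl : IsClosedFor WFiber μ C) (hcv : IsHorizontallyConvex C)
    {π : Z → Space d} (hπ : Measurable π) (hπ2 : MemLp π 2 ν) (hπμ : ν.map π = μ)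
    (h2 : MemLp Prod.snd 2 (ν ⊗ₘ τ)) (hC : (ν ⊗ₘ τ).map (fun p => (π p.1, p.2)) ∈ C) :
    ν.map (fun z => (π z, ∫ w, w ∂τ z)) ∈ C := by
  set m : Z → Space d := fun z => ∫ w, w ∂τ z with hmdef
  have hm : Measurable m := measurable_integral_kernel τ
  have hm2 : MemLp m 2 ν := memLp_integral_kernel h2
  set V : ℝ≥0∞ := ∫⁻ z, ∫⁻ w, ‖w - m z‖ₑ ^ 2 ∂τ z ∂ν with hV
  have key : ∀ n : ℕ, ∃ σ : Kernel Z (Space d), ∃ _ : IsMarkovKernel σ,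
      MemLp Prod.snd 2 (ν ⊗ₘ σ) ∧ (ν ⊗ₘ σ).map (fun p => (π p.1, p.2)) ∈ C ∧
      (∀ᵐ z ∂ν, ∫ w, w ∂σ z = m z) ∧
      ∫⁻ z, ∫⁻ w, ‖w - m z‖ₑ ^ 2 ∂σ z ∂ν = 2⁻¹ ^ n * V := by
    intro n
    induction n with
    | zero => exact ⟨τ, inferInstance, h2, hC, ae_of_all _ fun z => rfl, by simp [hV]⟩
    | succ n ih =>
      obtain ⟨σ, hσ, hσ2, hσC, hσm, hσV⟩ := ih
      refine ⟨averageKernel σ, inferInstance, (memLp_average hσ2).2.2,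
        averageKernel_map_mem hcv hπ hπ2 hσ2 hσC, ?_, ?_⟩
      · filter_upwards [hσm, ae_memLp_of_compProd hσ2] with z hz hz2
        rw [integral_averageKernel hz2, hz]
      · rw [pow_succ', mul_assoc, ← hσV, ← lintegral_const_mul _ (by fun_prop)]
        refine lintegral_congr_ae ?_
        filter_upwards [hσm, ae_memLp_of_compProd hσ2] with z hz hz2
        rw [← hz, variance_averageKernel hz2]
  have hVtop : V ≠ ∞ := by
    have hmp : MemLp (fun p : Z × Space d => m p.1) 2 (ν ⊗ₘ τ) := by
      have : ν = (ν ⊗ₘ τ).map Prod.fst := (Measure.fst_compProd _ _).symm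
      rw [this, memLp_comp_map_iff (by fun_prop) hm.stronglyMeasurable] at hm2
      exact hm2
    have := h2.sub hmp
    rw [memLp_two_iff_lintegral (by fun_prop), Measure.lintegral_compProd
      (by simp only [Pi.sub_apply]; fun_prop)] at this
    exact this.ne
  rw [isClosedFor_WFiber_iff] at hcl
  refine hcl _ (hπμ ▸ map_mem_fields hπ hm hπ2 hm2) fun ε hε => ?_
  have hlim : Tendsto (fun n : ℕ => (2⁻¹ : ℝ≥0∞) ^ n * V) atTop (𝓝 0) := by
    have := ENNReal.Tendsto.mul_const (ENNReal.tendsto_pow_atTop_nhds_zero_of_lt_one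
      (by simp : (2⁻¹ : ℝ≥0∞) < 1)) (Or.inr hVtop)
    simpa using this
  obtain ⟨n, hn⟩ := (hlim.eventually_lt_const (pos_iff_ne_zero.2 hε)).exists
  obtain ⟨σ, hσ, hσ2, hσC, hσm, hσV⟩ := key n
  refine ⟨_, hσC, ?_⟩
  have hfst : ν = (ν ⊗ₘ σ).map Prod.fst := (Measure.fst_compProd _ _).symm
  have hmap : ν.map (fun z => (π z, m z)) = (ν ⊗ₘ σ).map (fun p => (π p.1, m p.1)) := by
    conv_lhs => rw [hfst, Measure.map_map (by fun_prop) (by fun_prop)]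
    rfl
  rw [hfst, memLp_comp_map_iff (by fun_prop) hπ.stronglyMeasurable] at hπ2
  rw [hfst, memLp_comp_map_iff (by fun_prop) hm.stronglyMeasurable] at hm2
  rw [hmap]
  refine (WFiberSq_map_le (by fun_prop) (by fun_prop) (by fun_prop) hπ2 hσ2 hm2).trans_lt ?_
  rw [Measure.lintegral_compProd (by fun_prop), hσV]
  exact hn

end Averaging

/-! ### Centred fields -/

section Barycenter

open scoped ContDiff

variable {μ : Measure (Space d)} {ξ : Measure (TBundle d)}

lemma exists_kernel_of_mem_fields (hξ : ξ ∈ fields μ) :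
    ∃ κ : Kernel (Space d) (Space d), IsMarkovKernel κ ∧ ξ = μ ⊗ₘ κ := by
  have := (mem_fields_iff.1 hξ).1
  refine ⟨ξ.condKernel, inferInstance, ?_⟩
  rw [← hξ.2]
  exact (ξ.disintegrate ξ.condKernel).symm

lemma isProbabilityMeasure_of_mem_fields (hξ : ξ ∈ fields μ) : IsProbabilityMeasure μ := by
  have := (mem_fields_iff.1 hξ).1
  rw [← hξ.2]
  exact Measure.isProbabilityMeasure_map (by fun_prop)

lemma integrable_smul_of_memLp {g : Space d → ℝ} (hg : ContDiff ℝ ∞ g)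
    (hgs : HasCompactSupport g) {Z : Type*} [MeasurableSpace Z] {ν : Measure Z}
    [IsFiniteMeasure ν] {π f : Z → Space d} (hπ : Measurable π) (hf : MemLp f 2 ν) :
    Integrable (fun z => g (π z) • f z) ν := by
  obtain ⟨M, hM⟩ := hgs.exists_bound_of_continuous hg.continuous
  have hgc : Measurable g := hg.continuous.measurable
  exact Integrable.bdd_smul (hf.integrable one_le_two) M
    (hgc.comp hπ).aestronglyMeasurable (ae_of_all _ fun p => hM _)

lemma integral_smul_eq_zero_of_isBarycenter (hξ : ξ ∈ fields μ)
    (h : IsBarycenter μ ξ (fun _ => 0)) {g : Space d → ℝ} (hg : ContDiff ℝ ∞ g)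
    (hgs : HasCompactSupport g) : ∫ p, g p.1 • p.2 ∂ξ = 0 := by
  obtain ⟨hp, h1, h2, -⟩ := mem_fields_iff.1 hξ
  obtain ⟨M, hM⟩ := hgs.exists_bound_of_continuous hg.continuous
  have hgc : Continuous g := hg.continuous
  have hint : Integrable (fun p : TBundle d => g p.1 • p.2) ξ :=
    integrable_smul_of_memLp hg hgs measurable_fst h2
  refine ext_inner_left ℝ fun e => ?_
  rw [← integral_inner hint, inner_zero_right]
  have := h.2 (fun p => inner ℝ e (g p.1 • p.2)) (by fun_prop) ⟨M * ‖e‖, fun x v => ?_⟩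
    (fun x => ?_)
  · simpa using this
  · have h3 : |inner ℝ e (g x • v)| ≤ ‖e‖ * (M * ‖v‖) := by
      refine (abs_real_inner_le_norm _ _).trans ?_
      rw [norm_smul]
      gcongr
      exact hM x
    have hM0 : 0 ≤ M := (norm_nonneg _).trans (hM x)
    have : ‖v‖ ≤ 1 + ‖x‖ ^ 2 + ‖v‖ ^ 2 := by nlinarith [sq_nonneg (‖v‖ - 1), sq_nonneg ‖x‖]
    calc _ ≤ M * ‖e‖ * ‖v‖ := by linarith
      _ ≤ _ := by gcongr
  · constructor
    · intro v w
      simp [smul_add, inner_add_right]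
    · intro c v
      simp [inner_smul_right]
      ring

lemma ae_integral_eq_zero_of_forall_smul {κ : Kernel (Space d) (Space d)} [IsMarkovKernel κ]
    (hξ : μ ⊗ₘ κ ∈ fields μ)
    (h : ∀ g : Space d → ℝ, ContDiff ℝ ∞ g → HasCompactSupport g →
      ∫ p, g p.1 • p.2 ∂(μ ⊗ₘ κ) = 0) : ∀ᵐ x ∂μ, ∫ w, w ∂κ x = 0 := by
  have := isProbabilityMeasure_of_mem_fields hξ
  obtain ⟨hp, h1, h2, -⟩ := mem_fields_iff.1 hξ
  refine ae_eq_zero_of_integral_contDiff_smul_eq_zero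
    ((memLp_integral_kernel h2).integrable one_le_two).locallyIntegrable fun g hg hgs => ?_
  have hint : Integrable (fun p : TBundle d => g p.1 • p.2) (μ ⊗ₘ κ) :=
    integrable_smul_of_memLp hg hgs measurable_fst h2
  rw [← h g hg hgs, Measure.integral_compProd hint]
  exact integral_congr_ae (ae_of_all _ fun x => (integral_smul _ _).symm)

lemma isBarycenter_zero_of_ae {κ : Kernel (Space d) (Space d)} [IsMarkovKernel κ]
    (hξ : μ ⊗ₘ κ ∈ fields μ) (h : ∀ᵐ x ∂μ, ∫ w, w ∂κ x = 0) :
    IsBarycenter μ (μ ⊗ₘ κ) (fun _ => 0) := by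
  have := isProbabilityMeasure_of_mem_fields hξ
  obtain ⟨hp, h1, h2, -⟩ := mem_fields_iff.1 hξ
  refine ⟨MemLp.zero', fun φ hφ ⟨K, hK⟩ hlin => ?_⟩
  have hs1 := (memLp_two_iff_integrable_sq_norm h1.aestronglyMeasurable).1 h1
  have hs2 := (memLp_two_iff_integrable_sq_norm h2.aestronglyMeasurable).1 h2
  have hint : Integrable φ (μ ⊗ₘ κ) := by
    refine Integrable.mono' ((((integrable_const 1).add hs1).add hs2).const_mul K)
      (by fun_prop) (ae_of_all _ fun p => ?_)
    simpa using hK p.1 p.2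
  rw [Measure.integral_compProd hint]
  refine integral_congr_ae ?_
  filter_upwards [h, ae_memLp_of_compProd h2] with x hx hx2
  let T : Space d →L[ℝ] ℝ := LinearMap.toContinuousLinearMap (hlin x).mk'
  have := T.integral_comp_comm (μ := κ x) (φ := fun w => w) (hx2.integrable one_le_two)
  rw [hx] at this
  exact this

/-- Centredness only has to be tested on `φ(x, v) = ⟪g(x) e, v⟫` with `g` smooth and compactly
supported. -/
lemma mem_centredFields_iff : ξ ∈ centredFields μ ↔ ξ ∈ fields μ ∧
    ∀ g : Space d → ℝ, ContDiff ℝ ∞ g → HasCompactSupport g → ∫ p, g p.1 • p.2 ∂ξ = 0 := by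
  refine and_congr_right fun hξ => ⟨fun h g => integral_smul_eq_zero_of_isBarycenter hξ h, ?_⟩
  intro h
  obtain ⟨κ, hκ, rfl⟩ := exists_kernel_of_mem_fields hξ
  exact isBarycenter_zero_of_ae hξ (ae_integral_eq_zero_of_forall_smul hξ h)

lemma compProd_mem_centredFields_iff {κ : Kernel (Space d) (Space d)} [IsMarkovKernel κ] :
    μ ⊗ₘ κ ∈ centredFields μ ↔ μ ⊗ₘ κ ∈ fields μ ∧ ∀ᵐ x ∂μ, ∫ w, w ∂κ x = 0 :=
  and_congr_right fun hξ => ⟨fun h => ae_integral_eq_zero_of_forall_smul hξ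
    fun _ => integral_smul_eq_zero_of_isBarycenter hξ h, isBarycenter_zero_of_ae hξ⟩

lemma integral_smul_map {g : Space d → ℝ} (hg : ContDiff ℝ ∞ g)
    {Z : Type*} [MeasurableSpace Z] {ν : Measure Z}
    {π f : Z → Space d} (hπ : Measurable π) (hf : Measurable f) :
    ∫ p, g p.1 • p.2 ∂(ν.map (fun z => (π z, f z))) = ∫ z, g (π z) • f z ∂ν := by
  have hgc : Continuous g := hg.continuous
  rw [integral_map (by fun_prop) (by fun_prop)]

lemma isCone_centredFields : IsCone (centredFields μ) := by
  intro ξ hξ r hr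
  have h := mem_fields_iff.1 hξ.1
  have := h.1
  have hf := map_mem_fields (ν := ξ) (π := Prod.fst) (f := fun p => r • p.2)
    (by fun_prop) (by fun_prop) h.2.1 (h.2.2.1.const_smul r)
  rw [h.2.2.2] at hf
  refine mem_centredFields_iff.2 ⟨hf, fun g hg hgs => ?_⟩
  rw [scale, integral_smul_map hg (by fun_prop) (by fun_prop)]
  simp_rw [smul_comm _ r]
  rw [integral_smul, (mem_centredFields_iff.1 hξ).2 g hg hgs, smul_zero]

/-- The interpolation of two measure fields along a plan is a measure field. -/
lemma interpolation_mem_fields {ζ : Measure (TBundle d)} (hξ : ξ ∈ fields μ)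
    {α : Measure (T2Bundle d)} (hα : α ∈ fieldPlans ξ ζ) (t : ℝ) :
    α.map (fun p => (p.1, (1 - t) • p.2.1 + t • p.2.2)) ∈ fields μ := by
  obtain ⟨hp, h1, h2, h3, h4, -⟩ := mem_fieldPlans_iff.1 hα
  have hf := map_mem_fields (ν := α) (π := Prod.fst)
    (f := fun p => (1 - t) • p.2.1 + t • p.2.2) (by fun_prop) (by fun_prop) h1
    ((h2.const_smul (1 - t)).add (h3.const_smul t))
  have : α.map Prod.fst = μ := by
    rw [← hξ.2, ← h4, Measure.map_map (by fun_prop) (by fun_prop)]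
    rfl
  rwa [this] at hf

lemma isHorizontallyConvex_centredFields : IsHorizontallyConvex (centredFields μ) := by
  intro ξ hξ ζ hζ α hα t ht
  obtain ⟨hp, h1, h2, h3, h4, h5⟩ := mem_fieldPlans_iff.1 hα
  refine mem_centredFields_iff.2 ⟨interpolation_mem_fields hξ.1 hα t, fun g hg hgs => ?_⟩
  have hξ' := (mem_centredFields_iff.1 hξ).2 g hg hgs
  have hζ' := (mem_centredFields_iff.1 hζ).2 g hg hgs
  rw [← h4, integral_smul_map hg (by fun_prop) (by fun_prop)] at hξ'
  rw [← h5, integral_smul_map hg (by fun_prop) (by fun_prop)] at hζ'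
  rw [integral_smul_map hg (by fun_prop) (by fun_prop)]
  simp_rw [smul_add, smul_comm _ (1 - t), smul_comm _ t]
  have hi2 := (integrable_smul_of_memLp hg hgs (π := Prod.fst) measurable_fst h2).smul (1 - t)
  have hi3 := (integrable_smul_of_memLp hg hgs (π := Prod.fst) measurable_fst h3).smul t
  simp only [Pi.smul_def] at hi2 hi3
  rw [integral_add hi2 hi3, integral_smul, integral_smul, hξ', hζ']
  simp

end Barycenter

/-! ### Limits for the distance on the tangent bundle -/

section TangentLimits

lemma lintegral_enorm_mul_le {Z F G : Type*} [MeasurableSpace Z] {ν : Measure Z}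
    [NormedAddCommGroup F] [NormedAddCommGroup G] {f : Z → F} {g : Z → G}
    (hf : AEStronglyMeasurable f ν) (hg : AEStronglyMeasurable g ν) :
    ∫⁻ z, ‖f z‖ₑ * ‖g z‖ₑ ∂ν ≤ eLpNorm f 2 ν * eLpNorm g 2 ν := by
  have := ENNReal.lintegral_mul_le_Lp_mul_Lq ν Real.HolderConjugate.two_two hf.enorm hg.enorm
  rw [eLpNorm_eq_lintegral_rpow_enorm_toReal (by norm_num) (by norm_num),
    eLpNorm_eq_lintegral_rpow_enorm_toReal (by norm_num) (by norm_num)]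
  exact this

variable {u ξ : Measure (TBundle d)} {γ : Measure (TBundle d × TBundle d)} {δ : ℝ≥0∞}

lemma eLpNorm_sub_le_of_cost
    (hγ : ∫⁻ p, (edist p.1.1 p.2.1 ^ 2 + edist p.1.2 p.2.2 ^ 2) ∂γ < δ ^ 2) :
    eLpNorm (fun p => p.2.1 - p.1.1) 2 γ ≤ δ ∧ eLpNorm (fun p => p.2.2 - p.1.2) 2 γ ≤ δ := by
  constructor <;>
  · rw [← ENNReal.pow_le_pow_left_iff two_ne_zero, eLpNorm_two_sq]
    refine le_trans (lintegral_mono fun p => ?_) hγ.le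
    simp only [← edist_eq_enorm_sub]
    rw [edist_comm]
    simp

lemma ennreal_eq_zero_of_forall_le_mul {X K : ℝ≥0∞} (hK : K ≠ ⊤)
    (h : ∀ δ : ℝ≥0∞, δ ≠ 0 → δ ≤ 1 → X ≤ K * δ) : X = 0 := by
  have hlim : Tendsto (fun n : ℕ => K * ((n : ℝ≥0∞)⁻¹)) atTop (𝓝 0) := by
    have := ENNReal.Tendsto.const_mul (a := K) ENNReal.tendsto_inv_nat_nhds_zero (Or.inr hK)
    simpa using this
  refine le_antisymm (ge_of_tendsto hlim ?_) zero_le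
  filter_upwards [eventually_ge_atTop 1] with n hn
  exact h _ (by simp) (by simpa using hn)

lemma isClosedFor_WTangent_centredFields {μ : Measure (Space d)} :
    IsClosedFor WTangent μ (centredFields μ) := by
  rw [isClosedFor_WTangent_iff]
  intro ξ hξ happ
  refine mem_centredFields_iff.2 ⟨hξ, fun g hg hgs => ?_⟩
  obtain ⟨M, hM⟩ := hgs.exists_bound_of_continuous hg.continuous
  obtain ⟨L, hL⟩ := hg.lipschitzWith_of_hasCompactSupport hgs (by simp)
  obtain ⟨hp, -, hξ2, -⟩ := mem_fields_iff.1 hξ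
  rw [← enorm_eq_zero]
  refine ennreal_eq_zero_of_forall_le_mul
    (K := L * eLpNorm Prod.snd 2 ξ + ENNReal.ofReal M) (by have := hξ2.2.ne; finiteness)
    fun δ hδ _ => ?_
  obtain ⟨u, hu, γ, ⟨hγu, hγξ⟩, hcost⟩ := happ (δ ^ 2) (by simpa using hδ)
  obtain ⟨hc1, hc2⟩ := eLpNorm_sub_le_of_cost hcost
  have hup := (mem_fields_iff.1 hu.1).1
  have hγp : IsProbabilityMeasure γ := by
    constructor
    have := hup.measure_univ
    rwa [← hγu, Measure.map_apply (by fun_prop) MeasurableSet.univ] at this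
  have hgc : Continuous g := hg.continuous
  have hu2 := (mem_fields_iff.1 hu.1).2.2.1
  rw [← hγu, memLp_comp_map_iff (by fun_prop) measurable_snd.stronglyMeasurable] at hu2
  have hξ2' := hξ2
  rw [← hγξ, memLp_comp_map_iff (by fun_prop) measurable_snd.stronglyMeasurable] at hξ2'
  have hSe : eLpNorm (fun p : TBundle d × TBundle d => p.2.2) 2 γ = eLpNorm Prod.snd 2 ξ := by
    rw [← hγξ, eLpNorm_map_measure (by fun_prop) (by fun_prop)]
    rfl
  have hu0 := (mem_centredFields_iff.1 hu).2 g hg hgs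
  have e1 : ∫ p, g p.1 • p.2 ∂ξ = ∫ q, g q.2.1 • q.2.2 ∂γ := by
    rw [← hγξ, integral_map (by fun_prop) (by fun_prop)]
  have e2 : ∫ p, g p.1 • p.2 ∂u = ∫ q, g q.1.1 • q.1.2 ∂γ := by
    rw [← hγu, integral_map (by fun_prop) (by fun_prop)]
  have e3 : ∫ p, g p.1 • p.2 ∂ξ = ∫ q, (g q.2.1 • q.2.2 - g q.1.1 • q.1.2) ∂γ := by
    rw [integral_sub (integrable_smul_of_memLp hg hgs (by fun_prop) hξ2')
      (integrable_smul_of_memLp hg hgs (by fun_prop) hu2), ← e1, ← e2, hu0, sub_zero]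
  rw [e3]
  calc _ ≤ ∫⁻ q, ‖g q.2.1 • q.2.2 - g q.1.1 • q.1.2‖ₑ ∂γ := enorm_integral_le_lintegral_enorm _
    _ ≤ ∫⁻ q, (L * (‖q.2.1 - q.1.1‖ₑ * ‖q.2.2‖ₑ) +
          ENNReal.ofReal M * (‖(1 : ℝ)‖ₑ * ‖q.2.2 - q.1.2‖ₑ)) ∂γ := by
        refine lintegral_mono fun q => ?_
        have : g q.2.1 • q.2.2 - g q.1.1 • q.1.2 =
          (g q.2.1 - g q.1.1) • q.2.2 + g q.1.1 • (q.2.2 - q.1.2) := by module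
        rw [this]
        refine (enorm_add_le _ _).trans ?_
        rw [enorm_smul, enorm_smul, ← mul_assoc, enorm_one, one_mul]
        gcongr
        · rw [← edist_eq_enorm_sub, ← edist_eq_enorm_sub]
          exact hL _ _
        · rw [← ofReal_norm]
          exact ENNReal.ofReal_le_ofReal (hM _)
    _ ≤ L * (δ * eLpNorm Prod.snd 2 ξ) + ENNReal.ofReal M * (1 * δ) := by
        rw [lintegral_add_left (by fun_prop), lintegral_const_mul _ (by fun_prop),
          lintegral_const_mul _ (by fun_prop)]
        gcongr
        · refine (lintegral_enorm_mul_le (by fun_prop) (by fun_prop)).trans ?_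
          rw [hSe]
          gcongr
        · refine (lintegral_enorm_mul_le (f := fun _ => (1 : ℝ)) (by fun_prop)
            (by fun_prop)).trans ?_
          gcongr
          simp [eLpNorm_const']
    _ = _ := by ring

lemma isClosedFor_WFiber_of_WTangent {μ : Measure (Space d)} {C : Set (Measure (TBundle d))}
    (h : IsClosedFor WTangent μ C) : IsClosedFor WFiber μ C := by
  rw [isClosedFor_WFiber_iff]
  rw [isClosedFor_WTangent_iff] at h
  refine fun ξ hξ happ => h ξ hξ fun ε hε => ?_
  obtain ⟨u, hu, hlt⟩ := happ ε hε
  obtain ⟨α, hα, hlt⟩ := WFiberSq_lt_iff.1 hlt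
  obtain ⟨-, h4, h5⟩ := hα
  refine ⟨u, hu, α.map (fun p => ((p.1, p.2.1), (p.1, p.2.2))), ⟨?_, ?_⟩, ?_⟩
  · rw [Measure.map_map (by fun_prop) (by fun_prop)]
    exact h4
  · rw [Measure.map_map (by fun_prop) (by fun_prop)]
    exact h5
  · rw [lintegral_map (by fun_prop) (by fun_prop)]
    simpa using hlt

end TangentLimits

/-! ### Tilted kernels -/

section Tilt

variable {μ : Measure (Space d)} [IsProbabilityMeasure μ]
  {κ η : Kernel (Space d) (Space d)} [IsMarkovKernel κ] [IsMarkovKernel η]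
  {k θ : TBundle d → ℝ}

/-- The density, with respect to `η_x`, of the tilted kernel at `(x, v)`. -/
def tiltDensity (η : Kernel (Space d) (Space d)) (k θ : TBundle d → ℝ) (z : TBundle d)
    (w : Space d) : ℝ :=
  1 + k z * (θ (z.1, w) - ∫ w', θ (z.1, w') ∂η z.1)

/-- The kernel `(x, v) ↦ (1 + k(x, v) (θ(x, ·) - ∫ θ(x, ·) dη_x)) η_x`: a modification of `η_x`,
correlated with `v` through `k`. -/
def tilt (η : Kernel (Space d) (Space d)) [IsMarkovKernel η] (k θ : TBundle d → ℝ) :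
    Kernel (TBundle d) (Space d) :=
  (η.comap Prod.fst measurable_fst).withDensity
    fun z w => ((tiltDensity η k θ z w).toNNReal : ℝ≥0∞)

lemma measurable_integral_kernel_right (hθ : Measurable θ) :
    Measurable fun x => ∫ w, θ (x, w) ∂η x :=
  (StronglyMeasurable.integral_kernel_prod_right (f := fun x w => θ (x, w))
    hθ.stronglyMeasurable).measurable

lemma measurable_tiltDensity (hk : Measurable k) (hθ : Measurable θ) :
    Measurable (Function.uncurry (tiltDensity η k θ)) := by
  have := measurable_integral_kernel_right (η := η) hθ
  exact measurable_const.add ((hk.comp measurable_fst).mul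
    ((hθ.comp ((measurable_fst.comp measurable_fst).prodMk measurable_snd)).sub
      (this.comp (measurable_fst.comp measurable_fst))))

lemma integrable_section (hθ : Measurable θ) (hθ1 : ∀ p, θ p ∈ Set.Icc (0 : ℝ) 1) (x : Space d) :
    Integrable (fun w => θ (x, w)) (η x) := by
  refine Integrable.of_bound (hθ.comp measurable_prodMk_left).aestronglyMeasurable 1
    (ae_of_all _ fun w => ?_)
  rw [Real.norm_of_nonneg (hθ1 _).1]
  exact (hθ1 _).2

lemma integral_section_mem (hθ : Measurable θ) (hθ1 : ∀ p, θ p ∈ Set.Icc (0 : ℝ) 1)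
    (x : Space d) : ∫ w, θ (x, w) ∂η x ∈ Set.Icc (0 : ℝ) 1 := by
  refine ⟨integral_nonneg fun w => (hθ1 _).1, ?_⟩
  have := integral_mono (integrable_section (η := η) hθ hθ1 x) (integrable_const 1)
    fun w => (hθ1 (x, w)).2
  simpa using this

lemma tiltDensity_nonneg (hk1 : ∀ p, |k p| ≤ 1) (hθ : Measurable θ)
    (hθ1 : ∀ p, θ p ∈ Set.Icc (0 : ℝ) 1) (z : TBundle d) (w : Space d) :
    0 ≤ tiltDensity η k θ z w := by
  have h1 := hθ1 (z.1, w)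
  have h2 := integral_section_mem (η := η) hθ hθ1 z.1
  have h3 : |k z * (θ (z.1, w) - ∫ w', θ (z.1, w') ∂η z.1)| ≤ 1 * 1 := by
    rw [abs_mul]
    refine mul_le_mul (hk1 z) ?_ (abs_nonneg _) zero_le_one
    rw [abs_le]
    constructor <;> linarith [h1.1, h1.2, h2.1, h2.2]
  unfold tiltDensity
  linarith [(abs_le.1 h3).1]

lemma integral_tilt (hk : Measurable k) (hk1 : ∀ p, |k p| ≤ 1) (hθ : Measurable θ)
    (hθ1 : ∀ p, θ p ∈ Set.Icc (0 : ℝ) 1) (z : TBundle d) {F : Type*} [NormedAddCommGroup F]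
    [NormedSpace ℝ F] (f : Space d → F) :
    ∫ w, f w ∂tilt η k θ z = ∫ w, tiltDensity η k θ z w • f w ∂η z.1 := by
  rw [tilt, Kernel.integral_withDensity (measurable_tiltDensity hk hθ).real_toNNReal]
  refine integral_congr_ae (ae_of_all _ fun w => ?_)
  simp only [NNReal.smul_def, Real.coe_toNNReal _ (tiltDensity_nonneg hk1 hθ hθ1 z w)]

lemma lintegral_tilt (hk : Measurable k) (hθ : Measurable θ) (z : TBundle d)
    {f : Space d → ℝ≥0∞} (hf : Measurable f) :
    ∫⁻ w, f w ∂tilt η k θ z = ∫⁻ w, ENNReal.ofReal (tiltDensity η k θ z w) * f w ∂η z.1 := by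
  rw [tilt, Kernel.lintegral_withDensity _ ?_ _ hf]
  · rfl
  · exact (measurable_tiltDensity hk hθ).real_toNNReal.coe_nnreal_ennreal

lemma isMarkovKernel_tilt (hk : Measurable k) (hk1 : ∀ p, |k p| ≤ 1) (hθ : Measurable θ)
    (hθ1 : ∀ p, θ p ∈ Set.Icc (0 : ℝ) 1) : IsMarkovKernel (tilt η k θ) := by
  refine ⟨fun z => ⟨?_⟩⟩
  have hi : Integrable (tiltDensity η k θ z) (η z.1) :=
    (integrable_const 1).add
      (((integrable_section hθ hθ1 z.1).sub (integrable_const _)).const_mul (k z))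
  rw [← lintegral_one, lintegral_tilt hk hθ z measurable_const]
  simp only [mul_one]
  rw [← ofReal_integral_eq_lintegral_ofReal hi
    (ae_of_all _ (tiltDensity_nonneg hk1 hθ hθ1 z))]
  have : ∫ w, tiltDensity η k θ z w ∂η z.1 = 1 := by
    have hi' : Integrable (fun w => k z * (θ (z.1, w) - ∫ w', θ (z.1, w') ∂η z.1)) (η z.1) :=
      ((integrable_section hθ hθ1 z.1).sub (integrable_const _)).const_mul (k z)
    unfold tiltDensity
    rw [integral_add (integrable_const _) hi', integral_const_mul,
      integral_sub (integrable_section hθ hθ1 z.1) (integrable_const _)]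
    simp
  rw [this, ENNReal.ofReal_one]

/-- Tilting does not change the law of `(x, w)`, because `k(x, ·)` has mean zero. -/
lemma map_compProd_tilt (hk : Measurable k) (hk1 : ∀ p, |k p| ≤ 1)
    (hk0 : ∀ x, ∫ v, k (x, v) ∂κ x = 0) (hθ : Measurable θ)
    (hθ1 : ∀ p, θ p ∈ Set.Icc (0 : ℝ) 1) :
    ((μ ⊗ₘ κ) ⊗ₘ tilt η k θ).map (fun p => (p.1.1, p.2)) = μ ⊗ₘ η := by
  have := isMarkovKernel_tilt (η := η) hk hk1 hθ hθ1
  ext s hs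
  have hm : Measurable fun p : TBundle d × Space d => (p.1.1, p.2) := by fun_prop
  rw [Measure.map_apply hm hs, ← lintegral_indicator_one (hs.preimage hm),
    ← lintegral_indicator_one hs]
  have hs1 : Measurable (s.indicator (1 : TBundle d → ℝ≥0∞)) := measurable_one.indicator hs
  have hs2 : Measurable (((fun p : TBundle d × Space d => (p.1.1, p.2)) ⁻¹' s).indicator
    (1 : TBundle d × Space d → ℝ≥0∞)) := measurable_one.indicator (hs.preimage hm)
  rw [Measure.lintegral_compProd hs2, Measure.lintegral_compProd hs2.lintegral_kernel_prod_right',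
    Measure.lintegral_compProd hs1]
  refine lintegral_congr fun x => ?_
  have hD := measurable_tiltDensity (η := η) hk hθ
  have hD' : Measurable fun q : Space d × Space d => ENNReal.ofReal
      (tiltDensity η k θ (x, q.1) q.2) * s.indicator (1 : TBundle d → ℝ≥0∞) (x, q.2) := by
    have : Measurable fun q : Space d × Space d => tiltDensity η k θ (x, q.1) q.2 :=
      hD.comp (by fun_prop : Measurable fun q : Space d × Space d => ((x, q.1), q.2))
    fun_prop
  calc _ = ∫⁻ v, ∫⁻ w, ENNReal.ofReal (tiltDensity η k θ (x, v) w) *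
          s.indicator (1 : TBundle d → ℝ≥0∞) (x, w) ∂η x ∂κ x := by
        refine lintegral_congr fun v => ?_
        exact lintegral_tilt hk hθ (x, v)
          (f := fun w => s.indicator (1 : TBundle d → ℝ≥0∞) (x, w)) (by fun_prop)
    _ = ∫⁻ w, ∫⁻ v, ENNReal.ofReal (tiltDensity η k θ (x, v) w) *
          s.indicator (1 : TBundle d → ℝ≥0∞) (x, w) ∂κ x ∂η x :=
        lintegral_lintegral_swap hD'.aemeasurable
    _ = _ := by
        refine lintegral_congr fun w => ?_
        have hDw : Measurable fun v => tiltDensity η k θ (x, v) w :=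
          hD.comp (by fun_prop : Measurable fun v : Space d => ((x, v), w))
        have hkx : Integrable (fun v => k (x, v)) (κ x) :=
          Integrable.of_bound (hk.comp measurable_prodMk_left).aestronglyMeasurable 1
            (ae_of_all _ fun v => hk1 _)
        have hi : Integrable (fun v => tiltDensity η k θ (x, v) w) (κ x) :=
          (integrable_const 1).add
            (hkx.mul_const (θ (x, w) - ∫ w', θ (x, w') ∂η x))
        rw [lintegral_mul_const _ (by fun_prop), ← ofReal_integral_eq_lintegral_ofReal hi
          (ae_of_all _ fun v => tiltDensity_nonneg hk1 hθ hθ1 (x, v) w)]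
        have : ∫ v, tiltDensity η k θ (x, v) w ∂κ x = 1 := by
          unfold tiltDensity
          simp only
          rw [integral_add (integrable_const _) (hkx.mul_const _), integral_mul_const, hk0]
          simp
        rw [this, ENNReal.ofReal_one, one_mul]

lemma integral_id_tilt (hk : Measurable k) (hk1 : ∀ p, |k p| ≤ 1) (hθ : Measurable θ)
    (hθ1 : ∀ p, θ p ∈ Set.Icc (0 : ℝ) 1) {x v : Space d} (h : MemLp id 2 (η x))
    (h0 : ∫ w, w ∂η x = 0) :
    ∫ w, w ∂tilt η k θ (x, v) = k (x, v) • ∫ w, θ (x, w) • w ∂η x := by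
  have hi : Integrable (fun w => w) (η x) := h.integrable one_le_two
  have hiθ : Integrable (fun w => θ (x, w) • w) (η x) := by
    refine Integrable.bdd_smul hi 1 (hθ.comp measurable_prodMk_left).aestronglyMeasurable
      (ae_of_all _ fun w => ?_)
    rw [Function.comp_apply, Real.norm_of_nonneg (hθ1 _).1]
    exact (hθ1 _).2
  rw [integral_tilt hk hk1 hθ hθ1]
  have : ∀ w, tiltDensity η k θ (x, v) w • w =
      (1 - k (x, v) * ∫ w', θ (x, w') ∂η x) • w + k (x, v) • θ (x, w) • w := by
    intro w
    unfold tiltDensity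
    module
  simp_rw [this]
  have hi1 : Integrable (fun w => (1 - k (x, v) * ∫ w', θ (x, w') ∂η x) • w) (η x) :=
    hi.smul (1 - k (x, v) * ∫ w', θ (x, w') ∂η x)
  have hi2 : Integrable (fun w => k (x, v) • θ (x, w) • w) (η x) := hiθ.smul (k (x, v))
  rw [integral_add hi1 hi2, integral_smul, integral_smul, h0, smul_zero, zero_add]

/-- Let `C` contain the centred field `μ ⊗ η`, and let `b(x) = ∫ θ(x, w) w dη_x(w)`. Then `C`
contains the image of any other field `μ ⊗ κ` by `(x, v) ↦ (x, k(x, v) b(x))`, as soon as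
`k(x, ·)` is bounded by `1` and has `κ_x`-mean zero: this is the conditional mean of the tilted
kernel. -/
lemma map_smul_mem {C : Set (Measure (TBundle d))} (hC : IsClosedConvexCentredCone μ C)
    (hκ : μ ⊗ₘ κ ∈ fields μ) (hη : μ ⊗ₘ η ∈ C) (hk : Measurable k) (hk1 : ∀ p, |k p| ≤ 1)
    (hk0 : ∀ x, ∫ v, k (x, v) ∂κ x = 0) (hθ : Measurable θ)
    (hθ1 : ∀ p, θ p ∈ Set.Icc (0 : ℝ) 1) :
    (μ ⊗ₘ κ).map (fun p => (p.1, k p • ∫ w, θ (p.1, w) • w ∂η p.1)) ∈ C := by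
  have := isMarkovKernel_tilt (η := η) hk hk1 hθ hθ1
  obtain ⟨hηf, hη0⟩ := compProd_mem_centredFields_iff.1 (hC.centred hη)
  have hη2 := (mem_fields_iff.1 hηf).2.2.1
  have hlaw := map_compProd_tilt (μ := μ) (η := η) hk hk1 hk0 hθ hθ1
  have h := map_integral_mem (ν := μ ⊗ₘ κ) (τ := tilt η k θ) (π := Prod.fst) hC.closed hC.convex
    measurable_fst (mem_fields_iff.1 hκ).2.1 hκ.2 ?_ (by rwa [hlaw])
  · convert! h using 1
    refine Measure.map_congr ?_
    have : ∀ᵐ x ∂μ, MemLp id 2 (η x) ∧ ∫ w, w ∂η x = 0 := (ae_memLp_of_compProd hη2).and hη0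
    rw [← Measure.fst_compProd μ κ] at this
    filter_upwards [ae_of_ae_map measurable_fst.aemeasurable this] with p hp
    rw [← integral_id_tilt hk hk1 hθ hθ1 hp.1 hp.2]
  · rw [← hlaw, memLp_comp_map_iff (by fun_prop) measurable_snd.stronglyMeasurable] at hη2
    exact hη2

end Tilt

/-! ### Separation in the space of square-integrable fields -/

section Separation

variable {μ : Measure (Space d)} {C : Set (Measure (TBundle d))} {ξ : Measure (TBundle d)}

/-- The closed convex cone of those `g ∈ L²(ξ)` for which `(π_x, g)_# ξ` belongs to `C`. -/
def fieldCone (hC : IsClosedConvexCentredCone μ C) (hne : C.Nonempty) (hξ : ξ ∈ fields μ) :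
    ProperCone ℝ (Lp (Space d) 2 ξ) where
  carrier := {g | ξ.map (fun p => (p.1, g p)) ∈ C}
  add_mem' := by
    intro f g hf hg
    obtain ⟨hp, h1, -, -⟩ := mem_fields_iff.1 hξ
    have hfm := (Lp.stronglyMeasurable f).measurable
    have hgm := (Lp.stronglyMeasurable g).measurable
    have h := hC.cone.map_mem (by fun_prop) (by fun_prop) (hC.convex.map_mem (ν := ξ)
      (π := Prod.fst) (by fun_prop) hfm hgm h1 (Lp.memLp f) (Lp.memLp g) hf hg (t := 2⁻¹)
      ⟨by norm_num, by norm_num⟩) (r := 2) (by norm_num)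
    have e : ξ.map (fun p => (p.1, (f + g : Lp (Space d) 2 ξ) p)) =
        ξ.map (fun p => (p.1, (2 : ℝ) • ((1 - 2⁻¹ : ℝ) • f p + (2⁻¹ : ℝ) • g p))) := by
      refine Measure.map_congr ?_
      filter_upwards [Lp.coeFn_add f g] with p hp
      rw [hp, Pi.add_apply]
      congr 1
      module
    change ξ.map _ ∈ C
    rw [e]
    exact h
  zero_mem' := by
    obtain ⟨ζ, hζ⟩ := hne
    have h := hC.cone ζ hζ 0 le_rfl
    have e : ξ.map (fun p => (p.1, (0 : Lp (Space d) 2 ξ) p)) = scale 0 ζ := by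
      have h1 : ξ.map (fun p => (p.1, (0 : Lp (Space d) 2 ξ) p)) =
          ξ.map (fun p => (p.1, (0 : Space d))) := by
        refine Measure.map_congr ?_
        filter_upwards [Lp.coeFn_zero (Space d) 2 ξ] with p hp
        rw [hp, Pi.zero_apply]
      have h2 : ∀ σ ∈ fields μ, σ.map (fun p => (p.1, (0 : Space d))) =
          μ.map (fun x => (x, (0 : Space d))) := by
        intro σ hσ
        rw [← hσ.2, Measure.map_map (by fun_prop) (by fun_prop)]
        rfl
      rw [h1, h2 ξ hξ, ← h2 ζ (hC.centred hζ).1]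
      simp [scale]
    change ξ.map _ ∈ C
    rw [e]
    exact h
  smul_mem' := by
    intro r f hf
    have hfm := (Lp.stronglyMeasurable f).measurable
    have h := hC.cone.map_mem (ν := ξ) (π := Prod.fst) (by fun_prop) hfm hf r.2
    have e : ξ.map (fun p => (p.1, (r • f : Lp (Space d) 2 ξ) p)) =
        ξ.map (fun p => (p.1, (r : ℝ) • f p)) := by
      refine Measure.map_congr ?_
      filter_upwards [Lp.coeFn_smul (r : ℝ) f] with p hp
      rw [← Pi.smul_apply, ← hp]
      rfl
    change ξ.map _ ∈ C
    rw [e]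
    exact h
  isClosed' := by
    obtain ⟨hp, h1, -, -⟩ := mem_fields_iff.1 hξ
    refine IsSeqClosed.isClosed fun u f hu hlim => ?_
    have hm : ∀ g : Lp (Space d) 2 ξ, Measurable g := fun g => (Lp.stronglyMeasurable g).measurable
    have hf := map_mem_fields (ν := ξ) (π := Prod.fst) (by fun_prop) (hm f) h1 (Lp.memLp f)
    rw [hξ.2] at hf
    refine isClosedFor_WFiber_iff.1 hC.closed _ hf fun ε hε => ?_
    have hlim2 : Tendsto (fun n => edist (u n) f ^ 2) atTop (𝓝 0) := by
      have := ((ENNReal.continuous_pow 2).tendsto 0).comp (tendsto_iff_edist_tendsto_0.1 hlim)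
      simpa [Function.comp_def] using this
    obtain ⟨n, hn⟩ := (hlim2.eventually_lt_const (pos_iff_ne_zero.2 hε)).exists
    refine ⟨_, hu n, (WFiberSq_map_le (by fun_prop) (hm _) (hm _) h1 (Lp.memLp _)
      (Lp.memLp _)).trans_lt ?_⟩
    rw [Lp.edist_def, eLpNorm_two_sq] at hn
    exact hn

lemma exists_separating (hC : IsClosedConvexCentredCone μ C) (hne : C.Nonempty)
    (hξ : ξ ∈ fields μ) (hξC : ξ ∉ C) :
    ∃ h : TBundle d → Space d, Measurable h ∧ MemLp h 2 ξ ∧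
      (∀ g : TBundle d → Space d, Measurable g → MemLp g 2 ξ →
        ξ.map (fun p => (p.1, g p)) ∈ C → 0 ≤ ∫ p, inner ℝ (g p) (h p) ∂ξ) ∧
      ∫ p, inner ℝ p.2 (h p) ∂ξ < 0 := by
  obtain ⟨hp, h1, h2, -⟩ := mem_fields_iff.1 hξ
  have hmem : ∀ (g : TBundle d → Space d) (hg : MemLp g 2 ξ),
      hg.toLp ∈ fieldCone hC hne hξ ↔ ξ.map (fun p => (p.1, g p)) ∈ C := by
    intro g hg
    have e : ξ.map (fun p => (p.1, hg.toLp g p)) = ξ.map (fun p => (p.1, g p)) := by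
      refine Measure.map_congr ?_
      filter_upwards [hg.coeFn_toLp] with p hp
      rw [hp]
    rw [← e]
    rfl
  have hnot : h2.toLp ∉ fieldCone hC hne hξ := by
    rw [hmem]
    simpa using hξC
  obtain ⟨y, hy, hy0⟩ := (fieldCone hC hne hξ).hyperplane_separation' hnot
  have hinner : ∀ (g : TBundle d → Space d) (hg : MemLp g 2 ξ),
      inner ℝ hg.toLp y = ∫ p, inner ℝ (g p) (y p) ∂ξ := by
    intro g hg
    rw [L2.inner_def]
    refine integral_congr_ae ?_
    filter_upwards [hg.coeFn_toLp] with p hp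
    rw [hp]
  refine ⟨y, (Lp.stronglyMeasurable y).measurable, Lp.memLp y, fun g hgm hg hgC => ?_, ?_⟩
  · rw [← hinner g hg]
    exact hy _ ((hmem g hg).2 hgC)
  · rw [← hinner _ h2]
    exact hy0

end Separation

/-! ### Fibrewise means -/

section FibreMean

variable {μ : Measure (Space d)} [IsProbabilityMeasure μ]
  {κ η : Kernel (Space d) (Space d)} [IsMarkovKernel κ] [IsMarkovKernel η]
  {h : TBundle d → Space d} {c : Space d → Space d}

lemma memLp_comp_fst_compProd (hc : Measurable c) (hc2 : MemLp c 2 μ) :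
    MemLp (fun p => c p.1) 2 (μ ⊗ₘ κ) := by
  rw [← Measure.fst_compProd μ κ, Measure.fst,
    memLp_comp_map_iff (by fun_prop) hc.stronglyMeasurable] at hc2
  exact hc2

lemma measurable_fibreMean (hh : Measurable h) : Measurable fun x => ∫ v, h (x, v) ∂κ x :=
  (StronglyMeasurable.integral_kernel_prod_right (f := fun x w => h (x, w))
    hh.stronglyMeasurable).measurable

lemma memLp_fibreMean (hh : Measurable h) (h2 : MemLp h 2 (μ ⊗ₘ κ)) :
    MemLp (fun x => ∫ v, h (x, v) ∂κ x) 2 μ := by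
  rw [memLp_two_iff_lintegral (measurable_fibreMean hh).aestronglyMeasurable]
  rw [memLp_two_iff_lintegral (by fun_prop), Measure.lintegral_compProd (by fun_prop)] at h2
  exact (lintegral_mono fun x => enorm_integral_sq_le
    (hh.comp measurable_prodMk_left).aestronglyMeasurable).trans_lt h2

lemma ae_integrable_section (h2 : MemLp h 2 (μ ⊗ₘ κ)) :
    ∀ᵐ x ∂μ, Integrable (fun v => h (x, v)) (κ x) := by
  have hi := h2.integrable one_le_two
  exact ((Measure.integrable_compProd_iff hi.1).1 hi).1

lemma memLp_bdd_smul {Z : Type*} [MeasurableSpace Z] {ν : Measure Z} {φ : Z → ℝ}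
    {f : Z → Space d} (hφ : Measurable φ) (hφ1 : ∀ z, |φ z| ≤ 1) (hf : MemLp f 2 ν) :
    MemLp (fun z => φ z • f z) 2 ν := by
  refine hf.mono (hφ.aestronglyMeasurable.smul hf.aestronglyMeasurable) (ae_of_all _ fun z => ?_)
  rw [norm_smul]
  exact mul_le_of_le_one_left (norm_nonneg _) (hφ1 z)

lemma integral_inner_fibreMean (hc : Measurable c) (hc2 : MemLp c 2 μ)
    (h2 : MemLp h 2 (μ ⊗ₘ κ)) :
    ∫ p, inner ℝ (c p.1) (h p) ∂(μ ⊗ₘ κ) = ∫ x, inner ℝ (c x) (∫ v, h (x, v) ∂κ x) ∂μ := by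
  rw [Measure.integral_compProd (integrable_inner_of_memLp (memLp_comp_fst_compProd hc hc2) h2)]
  refine integral_congr_ae ?_
  filter_upwards [ae_integrable_section h2] with x hx
  exact integral_inner hx _

/-- A centred field is orthogonal to the fields that depend only on the base point. -/
lemma integral_inner_eq_zero_of_centred {ξ : Measure (TBundle d)} (hξ : ξ ∈ centredFields μ)
    (hc : Measurable c) (hc2 : MemLp c 2 μ) : ∫ p, inner ℝ p.2 (c p.1) ∂ξ = 0 := by
  obtain ⟨σ, hσ, rfl⟩ := exists_kernel_of_mem_fields hξ.1
  obtain ⟨hf, h0⟩ := compProd_mem_centredFields_iff.1 hξ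
  simp_rw [real_inner_comm (c _)]
  rw [integral_inner_fibreMean hc hc2 (mem_fields_iff.1 hf).2.2.1]
  refine integral_eq_zero_of_ae ?_
  filter_upwards [h0] with x hx
  rw [hx, inner_zero_right, Pi.zero_apply]

end FibreMean

/-! ### Elements of the polar cone -/

section Polar

variable {μ : Measure (Space d)} [IsProbabilityMeasure μ] {C : Set (Measure (TBundle d))}
  {κ η : Kernel (Space d) (Space d)} [IsMarkovKernel κ] [IsMarkovKernel η]
  {h : TBundle d → Space d}

lemma abs_sub_le_one_of_mem_Icc {a b : ℝ} (ha : a ∈ Set.Icc (0 : ℝ) 1)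
    (hb : b ∈ Set.Icc (0 : ℝ) 1) : |a - b| ≤ 1 := by
  rw [abs_le]
  constructor <;> linarith [ha.1, ha.2, hb.1, hb.2]

lemma indicator_one_mem_Icc {Z : Type*} (S : Set Z) (z : Z) :
    S.indicator (1 : Z → ℝ) z ∈ Set.Icc (0 : ℝ) 1 := by
  by_cases hz : z ∈ S <;> simp [hz]

/-- If `h` has fibrewise mean zero and lies in the polar of `C`, then it is fibrewise orthogonal to
every partial mean `∫ θ(x, w) w dη_x(w)` of a member `μ ⊗ η` of `C`. -/
lemma ae_inner_partialMean_eq_zero (hC : IsClosedConvexCentredCone μ C)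
    (hκ : μ ⊗ₘ κ ∈ fields μ) (hη : μ ⊗ₘ η ∈ C) (h2 : MemLp h 2 (μ ⊗ₘ κ))
    (h0 : ∀ᵐ x ∂μ, ∫ v, h (x, v) ∂κ x = 0)
    (hpol : ∀ g : TBundle d → Space d, Measurable g → MemLp g 2 (μ ⊗ₘ κ) →
        (μ ⊗ₘ κ).map (fun p => (p.1, g p)) ∈ C → 0 ≤ ∫ p, inner ℝ (g p) (h p) ∂(μ ⊗ₘ κ))
    {θ : TBundle d → ℝ} (hθ : Measurable θ) (hθ1 : ∀ p, θ p ∈ Set.Icc (0 : ℝ) 1) :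
    ∀ᵐ p ∂(μ ⊗ₘ κ), inner ℝ (∫ w, θ (p.1, w) • w ∂η p.1) (h p) = 0 := by
  have hη2 := (mem_fields_iff.1 (hC.centred hη).1).2.2.1
  have hθabs : ∀ p, |θ p| ≤ 1 := fun p => by
    rw [abs_of_nonneg (hθ1 p).1]
    exact (hθ1 p).2
  set b : Space d → Space d := fun x => ∫ w, θ (x, w) • w ∂η x with hbdef
  have hb : Measurable b := measurable_fibreMean (h := fun p => θ p • p.2) (by fun_prop)
  have hb2 : MemLp b 2 μ := memLp_fibreMean (h := fun p => θ p • p.2) (by fun_prop)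
    (memLp_bdd_smul hθ hθabs hη2)
  have hbκ := memLp_comp_fst_compProd (κ := κ) hb hb2
  have hq : Integrable (fun p : TBundle d => inner ℝ (b p.1) (h p)) (μ ⊗ₘ κ) :=
    integrable_inner_of_memLp hbκ h2
  refine hq.ae_eq_zero_of_forall_setIntegral_eq_zero fun S hS _ => ?_
  set i : TBundle d → ℝ := S.indicator 1 with hi
  have him : Measurable i := measurable_one.indicator hS
  have hi1 : ∀ p, i p ∈ Set.Icc (0 : ℝ) 1 := indicator_one_mem_Icc S
  set s : Space d → ℝ := fun x => ∫ v, i (x, v) ∂κ x with hs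
  have hsm : Measurable s := measurable_integral_kernel_right him
  have hs1 : ∀ x, s x ∈ Set.Icc (0 : ℝ) 1 := integral_section_mem him hi1
  have hsabs : ∀ x, |s x| ≤ 1 := fun x => by
    rw [abs_of_nonneg (hs1 x).1]
    exact (hs1 x).2
  -- `k = 1_S - E[1_S | x]` has fibrewise mean zero, and `- k` has the same properties.
  have hsign : ∀ ε : ℝ, |ε| = 1 → 0 ≤ ε * ∫ p, (i p - s p.1) * inner ℝ (b p.1) (h p) ∂(μ ⊗ₘ κ) := by
    intro ε hε
    have hk : Measurable fun p : TBundle d => ε * (i p - s p.1) := by fun_prop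
    have hk1 : ∀ p : TBundle d, |ε * (i p - s p.1)| ≤ 1 := fun p => by
      rw [abs_mul, hε, one_mul]
      exact abs_sub_le_one_of_mem_Icc (hi1 p) (hs1 p.1)
    have hk0 : ∀ x, ∫ v, ε * (i (x, v) - s x) ∂κ x = 0 := fun x => by
      rw [integral_const_mul, integral_sub (integrable_section him hi1 x) (integrable_const _)]
      simp [hs]
    have hmem := map_smul_mem hC hκ hη hk hk1 hk0 hθ hθ1
    have := hpol _ (hk.smul (hb.comp measurable_fst)) (memLp_bdd_smul hk hk1 hbκ) hmem
    simp only [inner_smul_left, Function.comp_apply, mul_assoc, Pi.smul_apply',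
      conj_trivial] at this
    rwa [integral_const_mul] at this
  have hzero : ∫ p, (i p - s p.1) * inner ℝ (b p.1) (h p) ∂(μ ⊗ₘ κ) = 0 := by
    have e1 := hsign 1 (by simp)
    have e2 := hsign (-1) (by simp)
    linarith
  have hsq : ∫ p, s p.1 * inner ℝ (b p.1) (h p) ∂(μ ⊗ₘ κ) = 0 := by
    have := integral_inner_fibreMean (κ := κ) (c := fun x => s x • b x) (hsm.smul hb)
      (memLp_bdd_smul hsm hsabs hb2) h2
    simp only [inner_smul_left, conj_trivial] at this
    rw [this]
    refine integral_eq_zero_of_ae ?_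
    filter_upwards [h0] with x hx
    rw [hx, inner_zero_right, mul_zero, Pi.zero_apply]
  have hint1 : Integrable (fun p : TBundle d => i p * inner ℝ (b p.1) (h p)) (μ ⊗ₘ κ) :=
    hq.bdd_mul (c := 1) him.aestronglyMeasurable (ae_of_all _ fun p => by
      rw [Real.norm_of_nonneg (hi1 p).1]; exact (hi1 p).2)
  have hint2 : Integrable (fun p : TBundle d => s p.1 * inner ℝ (b p.1) (h p)) (μ ⊗ₘ κ) :=
    hq.bdd_mul (c := 1) (hsm.comp measurable_fst).aestronglyMeasurable
      (ae_of_all _ fun p => hsabs p.1)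
  simp_rw [sub_mul] at hzero
  rw [integral_sub hint1 hint2, hsq, sub_zero] at hzero
  rw [← integral_indicator hS, ← hzero]
  refine integral_congr_ae (ae_of_all _ fun p => ?_)
  by_cases hp : p ∈ S <;> simp [hi, hp]

/-- With `h` as in `ae_inner_partialMean_eq_zero`, every partial mean `∫ φ(x, v) h(x, v) dκ_x(v)` is
a section of the base which is orthogonal to all members of `C`. -/
lemma ae_inner_section_eq_zero (hC : IsClosedConvexCentredCone μ C)
    (hκ : μ ⊗ₘ κ ∈ fields μ) (hm : Measurable h) (h2 : MemLp h 2 (μ ⊗ₘ κ))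
    (h0 : ∀ᵐ x ∂μ, ∫ v, h (x, v) ∂κ x = 0)
    (hpol : ∀ g : TBundle d → Space d, Measurable g → MemLp g 2 (μ ⊗ₘ κ) →
        (μ ⊗ₘ κ).map (fun p => (p.1, g p)) ∈ C → 0 ≤ ∫ p, inner ℝ (g p) (h p) ∂(μ ⊗ₘ κ))
    {φ : TBundle d → ℝ} (hφ : Measurable φ) (hφ1 : ∀ p, |φ p| ≤ 1)
    {ζ : Measure (TBundle d)} (hζ : ζ ∈ C) :
    ∀ᵐ p ∂ζ, inner ℝ p.2 (∫ v, φ (p.1, v) • h (p.1, v) ∂κ p.1) = 0 := by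
  obtain ⟨η, hη, rfl⟩ := exists_kernel_of_mem_fields (hC.centred hζ).1
  have hη2 := (mem_fields_iff.1 (hC.centred hζ).1).2.2.1
  set w : Space d → Space d := fun x => ∫ v, φ (x, v) • h (x, v) ∂κ x with hwdef
  have hφh := memLp_bdd_smul hφ hφ1 h2
  have hw : Measurable w := measurable_fibreMean (h := fun p => φ p • h p) (by fun_prop)
  have hw2 : MemLp w 2 μ := memLp_fibreMean (h := fun p => φ p • h p) (by fun_prop) hφh
  have hq := integrable_inner_of_memLp hη2 (memLp_comp_fst_compProd (κ := η) hw hw2)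
  refine hq.ae_eq_zero_of_forall_setIntegral_eq_zero fun S hS _ => ?_
  set i : TBundle d → ℝ := S.indicator 1 with hi
  have him : Measurable i := measurable_one.indicator hS
  have hi1 : ∀ p, i p ∈ Set.Icc (0 : ℝ) 1 := indicator_one_mem_Icc S
  have hiabs : ∀ p, |i p| ≤ 1 := fun p => by
    rw [abs_of_nonneg (hi1 p).1]
    exact (hi1 p).2
  have e : ∫ p in S, inner ℝ p.2 (w p.1) ∂(μ ⊗ₘ η) =
      ∫ p, inner ℝ (w p.1) (i p • p.2) ∂(μ ⊗ₘ η) := by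
    rw [← integral_indicator hS]
    refine integral_congr_ae (ae_of_all _ fun p => ?_)
    by_cases hp : p ∈ S <;> simp [hi, hp, real_inner_comm]
  rw [e, integral_inner_fibreMean hw hw2 (memLp_bdd_smul him hiabs hη2)]
  refine integral_eq_zero_of_ae ?_
  have hD := Measure.ae_ae_of_ae_compProd
    (ae_inner_partialMean_eq_zero hC hκ hζ h2 h0 hpol him hi1)
  filter_upwards [hD, ae_integrable_section hφh] with x hx hxi
  rw [Pi.zero_apply, real_inner_comm, hwdef, ← integral_inner hxi]
  refine integral_eq_zero_of_ae ?_
  filter_upwards [hx] with v hv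
  rw [inner_smul_right, hv, mul_zero, Pi.zero_apply]

end Polar

/-! ### Limits of pointwise orthogonality -/

section Limit

lemma enorm_inner_le_mul {E : Type*} [NormedAddCommGroup E] [InnerProductSpace ℝ E] (a b : E) :
    ‖(inner ℝ a b : ℝ)‖ₑ ≤ ‖a‖ₑ * ‖b‖ₑ := by
  rw [← ofReal_norm, ← ofReal_norm, ← ofReal_norm, ← ENNReal.ofReal_mul (norm_nonneg _)]
  exact ENNReal.ofReal_le_ofReal (norm_inner_le_norm a b)

/-- If every member of `C` is concentrated on `{(x, v) | ⟪v, w x⟫ = 0}`, with `w ∈ L²_μ`, then so is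
every `W_{TΩ}`-limit of members of `C`. -/
lemma ae_inner_eq_zero_of_limit {μ : Measure (Space d)} {C : Set (Measure (TBundle d))}
    (hCf : C ⊆ fields μ) {ξ : Measure (TBundle d)} (hξ : ξ ∈ fields μ)
    (happ : ∀ ε : ℝ≥0∞, ε ≠ 0 → ∃ u ∈ C, ∃ γ ∈ plans u ξ,
        ∫⁻ p, (edist p.1.1 p.2.1 ^ 2 + edist p.1.2 p.2.2 ^ 2) ∂γ < ε)
    {w : Space d → Space d} (hw : Measurable w) (hw2 : MemLp w 2 μ)
    (hwC : ∀ ζ ∈ C, ∀ᵐ p ∂ζ, inner ℝ p.2 (w p.1) = 0) :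
    ∀ᵐ p ∂ξ, inner ℝ p.2 (w p.1) = 0 := by
  have := isProbabilityMeasure_of_mem_fields hξ
  obtain ⟨hp, -, hξ2, -⟩ := mem_fields_iff.1 hξ
  set S := eLpNorm Prod.snd 2 ξ with hS
  have hStop : S ≠ ⊤ := hξ2.2.ne
  suffices H : ∫⁻ p, ‖(inner ℝ p.2 (w p.1) : ℝ)‖ₑ ∂ξ = 0 by
    rw [lintegral_eq_zero_iff (by fun_prop)] at H
    filter_upwards [H] with p hp
    simpa using hp
  refine ennreal_eq_zero_of_forall_le_mul (K := 3 * S + 2) (by finiteness) fun δ hδ hδ1 => ?_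
  have hδtop : δ ≠ ⊤ := ne_top_of_le_ne_top ENNReal.one_ne_top hδ1
  obtain ⟨g, hgs, hg, hgw⟩ := hw2.exist_eLpNorm_sub_le (by simp) one_le_two
    (ENNReal.toReal_pos hδ hδtop)
  rw [ENNReal.ofReal_toReal hδtop] at hgw
  obtain ⟨M, hM⟩ := hgs.exists_bound_of_continuous hg.continuous
  obtain ⟨L, hL⟩ := hg.lipschitzWith_of_hasCompactSupport hgs (by simp)
  have hgc : Continuous g := hg.continuous
  -- A plan of cost below `(δ / D) ^ 2` moves positions and velocities by at most `δ / D` in `L²`,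
  -- an error that stays below `δ` after multiplication by `L` or by `M`.
  set D : ℝ≥0∞ := L + ENNReal.ofReal M + 1 with hD
  have hDtop : D ≠ ⊤ := by finiteness
  obtain ⟨u, hu, γ, ⟨hγu, hγξ⟩, hcost⟩ := happ ((δ / D) ^ 2) (by simpa using ⟨hδ, hDtop⟩)
  obtain ⟨hc1, hc2⟩ := eLpNorm_sub_le_of_cost hcost
  have hcD : D * (δ / D) = δ := ENNReal.mul_div_cancel (by simp [hD]) hDtop
  have hcδ : δ / D ≤ δ := by
    calc δ / D ≤ D * (δ / D) := le_mul_of_one_le_left zero_le (by simp [hD])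
      _ = δ := hcD
  have hcL : L * (δ / D) ≤ δ := by
    calc L * (δ / D) ≤ D * (δ / D) := by gcongr; rw [hD, add_assoc]; exact le_self_add
      _ = δ := hcD
  have hcM : ENNReal.ofReal M * (δ / D) ≤ δ := by
    calc ENNReal.ofReal M * (δ / D) ≤ D * (δ / D) := by
          gcongr; rw [hD, add_right_comm]; exact le_add_self
      _ = δ := hcD
  have hSγ : eLpNorm (fun q : TBundle d × TBundle d => q.2.2) 2 γ = S := by
    rw [hS, ← hγξ, eLpNorm_map_measure (by fun_prop) (by fun_prop)]
    rfl
  have hVγ : eLpNorm (fun q : TBundle d × TBundle d => q.1.2) 2 γ ≤ S + δ := by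
    have e : (fun q : TBundle d × TBundle d => q.1.2) =
        (fun q => q.2.2) - fun q => q.2.2 - q.1.2 := by
      ext1 q
      simp
    rw [e, ← hSγ]
    exact (eLpNorm_sub_le (by fun_prop) (by fun_prop) one_le_two).trans
      (add_le_add le_rfl (hc2.trans hcδ))
  have hgm : Measurable g := hgc.measurable
  have hw1 : Measurable fun q : TBundle d × TBundle d => w q.1.1 - g q.1.1 := by fun_prop
  have hw2' : Measurable fun q : TBundle d × TBundle d => w q.2.1 - g q.2.1 := by fun_prop
  have hwγ : ∀ f : TBundle d × TBundle d → Space d, Measurable f → γ.map f = μ →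
      eLpNorm (fun q => w (f q) - g (f q)) 2 γ ≤ δ := by
    intro f hf hfμ
    refine le_trans (le_of_eq ?_) hgw
    rw [← hfμ, eLpNorm_map_measure (by fun_prop) hf.aemeasurable]
    rfl
  have h1 := hwγ (fun q => q.1.1) (by fun_prop) (by
    rw [← (hCf hu).2, ← hγu, Measure.map_map (by fun_prop) (by fun_prop)]; rfl)
  have h2 := hwγ (fun q => q.2.1) (by fun_prop) (by
    rw [← hξ.2, ← hγξ, Measure.map_map (by fun_prop) (by fun_prop)]; rfl)
  have huγ : ∀ᵐ q ∂γ, inner ℝ q.1.2 (w q.1.1) = (0 : ℝ) := by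
    have := hwC u hu
    rw [← hγu] at this
    exact ae_of_ae_map measurable_fst.aemeasurable this
  have hγp : γ Set.univ = 1 := by
    have := hp.measure_univ
    rwa [← hγξ, Measure.map_apply (by fun_prop) MeasurableSet.univ] at this
  have hone : eLpNorm (fun _ : TBundle d × TBundle d => (1 : ℝ)) 2 γ = 1 := by
    simp [eLpNorm_const', hγp]
  have eξ : ∫⁻ p, ‖(inner ℝ p.2 (w p.1) : ℝ)‖ₑ ∂ξ =
      ∫⁻ q, ‖(inner ℝ q.2.2 (w q.2.1) : ℝ)‖ₑ ∂γ := by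
    rw [← hγξ, lintegral_map (by fun_prop) (by fun_prop)]
  rw [eξ]
  calc _ ≤ ∫⁻ q, (‖q.2.2‖ₑ * ‖w q.2.1 - g q.2.1‖ₑ + L * (‖q.2.2‖ₑ * ‖q.2.1 - q.1.1‖ₑ) +
          ENNReal.ofReal M * (‖q.2.2 - q.1.2‖ₑ * ‖(1 : ℝ)‖ₑ) +
          ‖q.1.2‖ₑ * ‖w q.1.1 - g q.1.1‖ₑ) ∂γ := by
        refine lintegral_mono_ae ?_
        filter_upwards [huγ] with q hq
        have e : (inner ℝ q.2.2 (w q.2.1) : ℝ) = inner ℝ q.2.2 (w q.2.1 - g q.2.1) +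
            inner ℝ q.2.2 (g q.2.1 - g q.1.1) + inner ℝ (q.2.2 - q.1.2) (g q.1.1) -
            inner ℝ q.1.2 (w q.1.1 - g q.1.1) := by
          simp only [inner_sub_left, inner_sub_right, hq]
          ring
        rw [e]
        refine enorm_sub_le.trans (add_le_add ((enorm_add_le _ _).trans (add_le_add
          ((enorm_add_le _ _).trans (add_le_add (enorm_inner_le_mul _ _) ?_)) ?_))
          (enorm_inner_le_mul _ _))
        · refine (enorm_inner_le_mul _ _).trans ?_
          rw [mul_left_comm]
          gcongr
          rw [← edist_eq_enorm_sub, ← edist_eq_enorm_sub]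
          exact hL _ _
        · refine (enorm_inner_le_mul _ _).trans ?_
          rw [enorm_one, mul_one, mul_comm]
          gcongr
          rw [← ofReal_norm]
          exact ENNReal.ofReal_le_ofReal (hM _)
    _ ≤ S * δ + L * (S * (δ / D)) + ENNReal.ofReal M * ((δ / D) * 1) + (S + δ) * δ := by
        rw [lintegral_add_right _ (by fun_prop), lintegral_add_right _ (by fun_prop),
          lintegral_add_right _ (by fun_prop), lintegral_const_mul _ (by fun_prop),
          lintegral_const_mul _ (by fun_prop)]
        gcongr
        · refine (lintegral_enorm_mul_le (by fun_prop) hw2'.aestronglyMeasurable).trans ?_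
          rw [hSγ]
          gcongr
        · refine (lintegral_enorm_mul_le (by fun_prop) (by fun_prop)).trans ?_
          rw [hSγ]
          gcongr
        · refine (lintegral_enorm_mul_le (g := fun _ => (1 : ℝ)) (by fun_prop)
            (by fun_prop)).trans ?_
          rw [hone]
          gcongr
        · refine (lintegral_enorm_mul_le (by fun_prop) hw1.aestronglyMeasurable).trans ?_
          gcongr
    _ = S * δ + S * (L * (δ / D)) + ENNReal.ofReal M * (δ / D) + (S + δ) * δ := by ring
    _ ≤ S * δ + S * δ + δ + (S + 1) * δ := by gcongr
    _ = (3 * S + 2) * δ := by ring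

end Limit

/-! ### Orthogonality of independent copies -/

section Orthogonality

/-- If almost every vector `v` is orthogonal to almost every `f v'`, with `v` and `v'` drawn
independently, then `v` is orthogonal to `f v` almost surely: a finite basis of the space of
vectors orthogonal to almost every `f v'` provides a null set that does not depend on `v`. -/
lemma ae_inner_diag_eq_zero {E : Type*} [NormedAddCommGroup E] [InnerProductSpace ℝ E]
    [FiniteDimensional ℝ E] [MeasurableSpace E] {ρ : Measure E} {f : E → E}
    (h : ∀ᵐ v ∂ρ, ∀ᵐ v' ∂ρ, inner ℝ v (f v') = (0 : ℝ)) :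
    ∀ᵐ v ∂ρ, inner ℝ v (f v) = (0 : ℝ) := by
  let V : Submodule ℝ E :=
    { carrier := {u | ∀ᵐ v' ∂ρ, inner ℝ u (f v') = (0 : ℝ)}
      add_mem' := by
        intro a b ha hb
        change ∀ᵐ v' ∂ρ, inner ℝ (a + b) (f v') = (0 : ℝ)
        filter_upwards [ha, hb] with v' h1 h2
        rw [inner_add_left, h1, h2, add_zero]
      zero_mem' := ae_of_all _ fun v' => inner_zero_left _
      smul_mem' := by
        intro r a ha
        change ∀ᵐ v' ∂ρ, inner ℝ (r • a) (f v') = (0 : ℝ)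
        filter_upwards [ha] with v' h1
        rw [inner_smul_left, h1, mul_zero] }
  obtain ⟨s, hs⟩ := (IsNoetherian.noetherian V)
  have hs' : ∀ᵐ v' ∂ρ, ∀ u ∈ s, inner ℝ u (f v') = (0 : ℝ) := by
    refine (ae_ball_iff s.countable_toSet).2 ?_
    intro u hu
    have : u ∈ V := hs ▸ Submodule.subset_span hu
    exact this
  filter_upwards [h, hs'] with v hv hv'
  have hvV : v ∈ Submodule.span ℝ (s : Set E) := hs ▸ (show v ∈ V from hv)
  refine Submodule.span_induction (p := fun u _ => inner ℝ u (f v) = (0 : ℝ)) ?_ ?_ ?_ ?_ hvV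
  · exact fun u hu => hv' u hu
  · exact inner_zero_left _
  · intro a b _ _ ha hb
    rw [inner_add_left, ha, hb, add_zero]
  · intro r a _ ha
    rw [inner_smul_left, ha, mul_zero]

/-- The vectors `∫ f_j / (1 + ‖f‖) f dρ` span the same space as the essential range of `f`. -/
lemma ae_inner_eq_zero_of_forall_coord {ρ : Measure (Space d)} {f : Space d → Space d}
    (hf : Measurable f) (hfi : Integrable f ρ) {v : Space d}
    (h : ∀ j, inner ℝ v (∫ v', (f v' j / (1 + ‖f v'‖)) • f v' ∂ρ) = (0 : ℝ)) :
    ∀ᵐ v' ∂ρ, inner ℝ v (f v') = (0 : ℝ) := by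
  have hcoord : ∀ j, Measurable fun v' => f v' j := fun j => by fun_prop
  have hint : ∀ j, Integrable (fun v' => (f v' j / (1 + ‖f v'‖)) • f v') ρ := fun j => by
    refine Integrable.bdd_smul hfi 1
      ((hcoord j).div (by fun_prop)).aestronglyMeasurable (ae_of_all _ fun v' => ?_)
    rw [Pi.div_apply]
    have h1 : ‖f v' j‖ ≤ ‖f v'‖ := PiLp.norm_apply_le _ _
    rw [norm_div, Real.norm_of_nonneg (by positivity : 0 ≤ 1 + ‖f v'‖)]
    exact div_le_one_of_le₀ (by linarith) (by positivity)
  have hsum : ∀ v', ∑ j, v j * inner ℝ v ((f v' j / (1 + ‖f v'‖)) • f v') =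
      inner ℝ v (f v') ^ 2 / (1 + ‖f v'‖) := by
    intro v'
    have e : (inner ℝ v (f v') : ℝ) = ∑ j, v j * f v' j := by
      simp [PiLp.inner_apply, mul_comm]
    simp_rw [inner_smul_right]
    rw [sq, mul_div_right_comm]
    nth_rewrite 2 [e]
    rw [Finset.sum_div, Finset.sum_mul]
    refine Finset.sum_congr rfl fun j _ => ?_
    ring
  have hi2 : ∀ j ∈ Finset.univ,
      Integrable (fun v' => v j * inner ℝ v ((f v' j / (1 + ‖f v'‖)) • f v')) ρ :=
    fun j _ => ((hint j).const_inner v).const_mul (v j)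
  have hzero : ∫ v', inner ℝ v (f v') ^ 2 / (1 + ‖f v'‖) ∂ρ = 0 := by
    simp_rw [← hsum]
    rw [integral_finsetSum _ hi2]
    refine Finset.sum_eq_zero fun j _ => ?_
    rw [integral_const_mul, integral_inner (hint j), h j, mul_zero]
  have hi3 : Integrable (fun v' => inner ℝ v (f v') ^ 2 / (1 + ‖f v'‖)) ρ := by
    simp_rw [← hsum]
    exact integrable_finsetSum _ hi2
  rw [integral_eq_zero_iff_of_nonneg (fun v' => by positivity) hi3] at hzero
  filter_upwards [hzero] with v' hv'
  have hpos : (1 + ‖f v'‖) ≠ 0 := by positivity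
  have : inner ℝ v (f v') ^ 2 / (1 + ‖f v'‖) = (0 : ℝ) := hv'
  simpa [hpos] using this

end Orthogonality

/-! ### Closed convex cones of centred fields -/

section TangentClosed

/-- The central closedness statement. Were the limit `ξ = μ ⊗ κ` outside `C`, a vector `h` would
separate it from the cone of `g ∈ L²(ξ)` whose law is in `C`; after subtraction of its fibrewise
mean, `h` only sees sections of the base orthogonal to `C`, hence orthogonal to `ξ`. -/
theorem isClosedFor_WTangent_of_cone {μ : Measure (Space d)} {C : Set (Measure (TBundle d))}
    (hC : IsClosedConvexCentredCone μ C) : IsClosedFor WTangent μ C := by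
  rw [isClosedFor_WTangent_iff]
  intro ξ hξ happ
  by_contra hξC
  have := isProbabilityMeasure_of_mem_fields hξ
  have hne : C.Nonempty := by
    obtain ⟨u, hu, -⟩ := happ 1 one_ne_zero
    exact ⟨u, hu⟩
  have hcent : ξ ∈ centredFields μ := by
    refine isClosedFor_WTangent_iff.1 isClosedFor_WTangent_centredFields ξ hξ fun ε hε => ?_
    obtain ⟨u, hu, hu'⟩ := happ ε hε
    exact ⟨u, hC.centred hu, hu'⟩
  obtain ⟨h, hm, h2, hpol, hneg⟩ := exists_separating hC hne hξ hξC
  obtain ⟨κ, hκ, rfl⟩ := exists_kernel_of_mem_fields hξ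
  have hξ2 := (mem_fields_iff.1 hξ).2.2.1
  set a : Space d → Space d := fun x => ∫ v, h (x, v) ∂κ x with ha
  have ham : Measurable a := measurable_fibreMean hm
  have ha2 : MemLp a 2 μ := memLp_fibreMean hm h2
  have haκ := memLp_comp_fst_compProd (κ := κ) ham ha2
  set f : TBundle d → Space d := fun p => h p - a p.1 with hf
  have hfm : Measurable f := by fun_prop
  have hf2 : MemLp f 2 (μ ⊗ₘ κ) := h2.sub haκ
  have hf0 : ∀ᵐ x ∂μ, ∫ v, f (x, v) ∂κ x = 0 := by
    filter_upwards [ae_integrable_section h2] with x hx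
    simp only [hf]
    rw [integral_sub hx (integrable_const _)]
    simp [ha]
  -- Centred fields do not see the fibrewise mean `a` of `h`.
  have hsplit : ∀ g : TBundle d → Space d, Measurable g → MemLp g 2 (μ ⊗ₘ κ) →
      (μ ⊗ₘ κ).map (fun p => (p.1, g p)) ∈ centredFields μ →
      ∫ p, inner ℝ (g p) (f p) ∂(μ ⊗ₘ κ) = ∫ p, inner ℝ (g p) (h p) ∂(μ ⊗ₘ κ) := by
    intro g hg hg2 hgc
    have h0 := integral_inner_eq_zero_of_centred hgc ham ha2
    rw [integral_map (by fun_prop) (by fun_prop)] at h0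
    simp only [hf, inner_sub_right]
    rw [integral_sub (integrable_inner_of_memLp hg2 h2) (integrable_inner_of_memLp hg2 haκ), h0,
      sub_zero]
  have hfpol : ∀ g : TBundle d → Space d, Measurable g → MemLp g 2 (μ ⊗ₘ κ) →
      (μ ⊗ₘ κ).map (fun p => (p.1, g p)) ∈ C → 0 ≤ ∫ p, inner ℝ (g p) (f p) ∂(μ ⊗ₘ κ) := by
    intro g hg hg2 hgC
    rw [hsplit g hg hg2 (hC.centred hgC)]
    exact hpol g hg hg2 hgC
  have hcoord : ∀ j, ∀ᵐ p ∂(μ ⊗ₘ κ), inner ℝ p.2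
      (∫ v, (f (p.1, v) j / (1 + ‖f (p.1, v)‖)) • f (p.1, v) ∂κ p.1) = (0 : ℝ) := by
    intro j
    have hφ : Measurable fun p : TBundle d => f p j / (1 + ‖f p‖) := by fun_prop
    have hφ1 : ∀ p : TBundle d, |f p j / (1 + ‖f p‖)| ≤ 1 := fun p => by
      have h1 : |f p j| ≤ ‖f p‖ := PiLp.norm_apply_le (f p) j
      rw [abs_div, abs_of_nonneg (by positivity : 0 ≤ 1 + ‖f p‖)]
      exact div_le_one_of_le₀ (by linarith) (by positivity)
    refine ae_inner_eq_zero_of_limit (fun u hu => (hC.centred hu).1) hξ happ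
      (measurable_fibreMean (h := fun p => (f p j / (1 + ‖f p‖)) • f p) (by fun_prop))
      (memLp_fibreMean (h := fun p => (f p j / (1 + ‖f p‖)) • f p) (by fun_prop)
        (memLp_bdd_smul hφ hφ1 hf2)) fun ζ hζ => ?_
    exact ae_inner_section_eq_zero hC hξ hfm hf2 hf0 hfpol hφ hφ1 hζ
  have hdiag : ∀ᵐ p ∂(μ ⊗ₘ κ), inner ℝ p.2 (f p) = (0 : ℝ) := by
    refine Measure.ae_compProd_of_ae_ae
      (measurableSet_eq_fun (by fun_prop) measurable_const) ?_
    filter_upwards [Measure.ae_ae_of_ae_compProd (ae_all_iff.2 hcoord),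
      ae_integrable_section hf2] with x hx hxi
    refine ae_inner_diag_eq_zero (f := fun v => f (x, v)) ?_
    filter_upwards [hx] with v hv
    exact ae_inner_eq_zero_of_forall_coord (by fun_prop) hxi hv
  have hid : (μ ⊗ₘ κ).map (fun p => (p.1, p.2)) = μ ⊗ₘ κ := Measure.map_id
  have h0 := hsplit Prod.snd measurable_snd hξ2 (by rwa [hid])
  rw [← h0, integral_eq_zero_of_ae hdiag] at hneg
  exact lt_irrefl _ hneg

end TangentClosed

/-! ### Optimal plans -/

section Optimal

variable {Z : Type*} [MeasurableSpace Z] {ν : Measure Z} {X X' Y : Z → Space d}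

lemma memLp_of_map_eq (hX : Measurable X) (hX' : Measurable X') (hX2 : MemLp X 2 ν)
    (h : ν.map X' = ν.map X) : MemLp X' 2 ν := by
  have h1 : MemLp id 2 (ν.map X) := (memLp_comp_map_iff hX (by fun_prop)).2 hX2
  rw [← h] at h1
  exact (memLp_comp_map_iff (f := fun x => x) hX' (by fun_prop)).1 h1

lemma integral_norm_sub_sq {f g : Z → Space d} (hf : MemLp f 2 ν) (hg : MemLp g 2 ν) :
    ∫ z, ‖f z - g z‖ ^ 2 ∂ν =
      ∫ z, ‖f z‖ ^ 2 ∂ν - 2 * ∫ z, inner ℝ (f z) (g z) ∂ν + ∫ z, ‖g z‖ ^ 2 ∂ν := by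
  have i1 := (memLp_two_iff_integrable_sq_norm hf.aestronglyMeasurable).1 hf
  have i2 := (memLp_two_iff_integrable_sq_norm hg.aestronglyMeasurable).1 hg
  have i3 := (integrable_inner_of_memLp hf hg).const_mul 2
  have i13 : Integrable (fun z => ‖f z‖ ^ 2 - 2 * inner ℝ (f z) (g z)) ν := i1.sub i3
  simp_rw [norm_sub_sq_real]
  rw [integral_add i13 i2, integral_sub i1 i3, integral_const_mul]

/-- For a fixed first marginal, comparing quadratic costs amounts to comparing correlations: the
second moments of `X` and `X'` cancel. -/
lemma lintegral_edist_le_iff (hX : Measurable X) (hX' : Measurable X') (hX2 : MemLp X 2 ν)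
    (hY2 : MemLp Y 2 ν) (h : ν.map X' = ν.map X) :
    ∫⁻ z, edist (X z) (Y z) ^ 2 ∂ν ≤ ∫⁻ z, edist (X' z) (Y z) ^ 2 ∂ν ↔
      ∫ z, inner ℝ (X' z - X z) (Y z) ∂ν ≤ 0 := by
  have hX'2 := memLp_of_map_eq hX hX' hX2 h
  have hsq : ∫ z, ‖X' z‖ ^ 2 ∂ν = ∫ z, ‖X z‖ ^ 2 ∂ν := by
    rw [← integral_map (f := fun x => ‖x‖ ^ 2) hX.aemeasurable (by fun_prop), ← h,
      integral_map hX'.aemeasurable (by fun_prop)]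
  simp_rw [edist_eq_enorm_sub]
  have l1 := lintegral_enorm_sq_eq (hX2.sub hY2)
  have l2 := lintegral_enorm_sq_eq (hX'2.sub hY2)
  simp only [Pi.sub_apply] at l1 l2
  rw [l1, l2, ENNReal.ofReal_le_ofReal_iff (integral_nonneg fun z => by positivity),
    integral_norm_sub_sq hX2 hY2, integral_norm_sub_sq hX'2 hY2, hsq]
  simp_rw [inner_sub_left]
  rw [integral_sub (integrable_inner_of_memLp hX'2 hY2) (integrable_inner_of_memLp hX2 hY2)]
  constructor <;> intro h <;> linarith

lemma inner_nonpos_of_isOptimalPlan (hX : Measurable X) (hX' : Measurable X') (hY : Measurable Y)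
    (hX2 : MemLp X 2 ν) (hY2 : MemLp Y 2 ν) (h : ν.map X' = ν.map X)
    (hopt : IsOptimalPlan (ν.map (fun z => (X z, Y z)))) :
    ∫ z, inner ℝ (X' z - X z) (Y z) ∂ν ≤ 0 := by
  rw [← lintegral_edist_le_iff hX hX' hX2 hY2 h]
  have hmem : ν.map (fun z => (X' z, Y z)) ∈ plans ((ν.map (fun z => (X z, Y z))).map Prod.fst)
      ((ν.map (fun z => (X z, Y z))).map Prod.snd) := by
    constructor
    · rw [Measure.map_map (by fun_prop) (by fun_prop), Measure.map_map (by fun_prop) (by fun_prop)]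
      exact h
    · rw [Measure.map_map (by fun_prop) (by fun_prop), Measure.map_map (by fun_prop) (by fun_prop)]
      rfl
  have := hopt.trans_le (iInf₂_le _ hmem)
  rwa [lintegral_map (by fun_prop) (by fun_prop), lintegral_map (by fun_prop) (by fun_prop)] at this

/-- A coupling `(X, Y)` is optimal as soon as `E⟪X' - X, Y⟫ ≤ 0` for all rearrangements `X'` of `X`,
on any extension of the probability space. -/
lemma isOptimalPlan_of_inner_nonpos [IsProbabilityMeasure ν] (hX : Measurable X)
    (hY : Measurable Y) (hX2 : MemLp X 2 ν) (hY2 : MemLp Y 2 ν)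
    (h : ∀ γ : Measure (Z × Space d × Space d), γ.map Prod.fst = ν →
      γ.map (fun q => q.2.1) = γ.map (fun q => X q.1) →
      ∫ q, inner ℝ (q.2.1 - X q.1) (Y q.1) ∂γ ≤ 0) :
    IsOptimalPlan (ν.map (fun z => (X z, Y z))) := by
  refine le_antisymm (le_iInf₂ fun β hβ => ?_) (iInf₂_le _ ⟨rfl, rfl⟩)
  obtain ⟨hβ1, hβ2⟩ := hβ
  rw [Measure.map_map (by fun_prop) (by fun_prop)] at hβ1 hβ2
  have hβp : IsProbabilityMeasure β := by
    have : IsProbabilityMeasure (β.map Prod.fst) := by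
      rw [hβ1]
      exact Measure.isProbabilityMeasure_map (by fun_prop)
    exact Measure.isProbabilityMeasure_of_map Prod.fst
  obtain ⟨γ, hγp, hγ1, hγ2, hae⟩ := exists_glue (α := ν) (β := β) hY measurable_snd hβ2.symm
  have hXX : γ.map (fun q => q.2.1) = γ.map (fun q => X q.1) := by
    have e1 : γ.map (fun q => q.2.1) = β.map Prod.fst := by
      rw [← hγ2, Measure.map_map (by fun_prop) (by fun_prop)]
      rfl
    have e2 : γ.map (fun q => X q.1) = ν.map X := by
      rw [← hγ1, Measure.map_map (by fun_prop) (by fun_prop)]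
      rfl
    rw [e1, e2, hβ1]
    rfl
  have hle := h γ hγ1 hXX
  rw [← hγ1, memLp_comp_map_iff measurable_fst hX.stronglyMeasurable] at hX2
  rw [← hγ1, memLp_comp_map_iff measurable_fst hY.stronglyMeasurable] at hY2
  rw [← lintegral_edist_le_iff (X := fun q => X q.1) (by fun_prop) (by fun_prop) hX2 hY2 hXX] at hle
  rw [← hγ1, Measure.map_map (by fun_prop) (by fun_prop), lintegral_map (by fun_prop) (by fun_prop),
    ← hγ2, lintegral_map (by fun_prop) (by fun_prop)]
  refine hle.trans (le_of_eq (lintegral_congr_ae ?_))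
  filter_upwards [hae] with q hq
  rw [hq]

lemma isOptimalPlan_diag (hX : Measurable X) : IsOptimalPlan (ν.map (fun z => (X z, X z))) := by
  have h0 : ∫⁻ p, edist p.1 p.2 ^ 2 ∂(ν.map (fun z => (X z, X z))) = 0 := by
    rw [lintegral_map (by fun_prop) (by fun_prop)]
    simp
  rw [IsOptimalPlan, h0]
  refine (le_antisymm ?_ zero_le).symm
  rw [← h0]
  exact iInf₂_le _ ⟨rfl, rfl⟩

/-- The optimality of `(x, x + f)` is preserved by convex combinations of `f`, `g` and `0`: the
condition `E⟪X' - X, Y⟫ ≤ 0` is linear in `Y`. -/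
lemma isOptimalPlan_combination [IsProbabilityMeasure ν] {f g : Z → Space d} (hX : Measurable X)
    (hf : Measurable f) (hg : Measurable g) (hX2 : MemLp X 2 ν) (hf2 : MemLp f 2 ν)
    (hg2 : MemLp g 2 ν) (hfo : IsOptimalPlan (ν.map (fun z => (X z, X z + f z))))
    (hgo : IsOptimalPlan (ν.map (fun z => (X z, X z + g z)))) {a b : ℝ} (ha : 0 ≤ a) (hb : 0 ≤ b)
    (hab : a + b ≤ 1) :
    IsOptimalPlan (ν.map (fun z => (X z, X z + (a • f z + b • g z)))) := by
  refine isOptimalPlan_of_inner_nonpos hX (by fun_prop) hX2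
    (hX2.add ((hf2.const_smul a).add (hg2.const_smul b))) fun γ hγ hXX => ?_
  have hlaw : ∀ Y : Z → Space d, Measurable Y →
      ν.map (fun z => (X z, Y z)) = γ.map (fun q => (X q.1, Y q.1)) := fun Y hY => by
    rw [← hγ, Measure.map_map (by fun_prop) (by fun_prop)]
    rfl
  have hlift : ∀ Y : Z → Space d, Measurable Y → MemLp Y 2 ν →
      MemLp (fun q : Z × Space d × Space d => Y q.1) 2 γ := fun Y hY hY2 => by
    rwa [← hγ, memLp_comp_map_iff measurable_fst hY.stronglyMeasurable] at hY2
  have hXγ := hlift X hX hX2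
  have hX'γ := memLp_of_map_eq (X := fun q : Z × Space d × Space d => X q.1) (by fun_prop)
    (by fun_prop) hXγ hXX
  have hfγ := hlift _ (hX.add hf) (hX2.add hf2)
  have hgγ := hlift _ (hX.add hg) (hX2.add hg2)
  rw [hlaw (fun z => X z + f z) (by fun_prop)] at hfo
  rw [hlaw (fun z => X z + g z) (by fun_prop)] at hgo
  have i0 := inner_nonpos_of_isOptimalPlan (ν := γ) (X := fun q => X q.1) (by fun_prop)
    (by fun_prop) (by fun_prop) hXγ hXγ hXX (isOptimalPlan_diag (by fun_prop))
  have i1 := inner_nonpos_of_isOptimalPlan (ν := γ) (X := fun q => X q.1) (by fun_prop)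
    (by fun_prop) (by fun_prop) hXγ hfγ hXX hfo
  have i2 := inner_nonpos_of_isOptimalPlan (ν := γ) (X := fun q => X q.1) (by fun_prop)
    (by fun_prop) (by fun_prop) hXγ hgγ hXX hgo
  have j0 := integrable_inner_of_memLp (hX'γ.sub hXγ) hXγ
  have j1 := integrable_inner_of_memLp (hX'γ.sub hXγ) hfγ
  have j2 := integrable_inner_of_memLp (hX'γ.sub hXγ) hgγ
  simp only [Pi.sub_apply, Pi.add_apply] at i1 i2 j0 j1 j2
  have e : ∀ q : Z × Space d × Space d,
      (inner ℝ (q.2.1 - X q.1) (X q.1 + (a • f q.1 + b • g q.1)) : ℝ) =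
      (1 - a - b) * inner ℝ (q.2.1 - X q.1) (X q.1) +
        a * inner ℝ (q.2.1 - X q.1) (X q.1 + f q.1) +
        b * inner ℝ (q.2.1 - X q.1) (X q.1 + g q.1) := by
    intro q
    simp only [inner_add_right, inner_smul_right]
    ring
  have k01 : Integrable (fun q : Z × Space d × Space d =>
      (1 - a - b) * inner ℝ (q.2.1 - X q.1) (X q.1) +
        a * inner ℝ (q.2.1 - X q.1) (X q.1 + f q.1)) γ := (j0.const_mul _).add (j1.const_mul _)
  simp_rw [e]
  rw [integral_add k01 (j2.const_mul _), integral_add (j0.const_mul _) (j1.const_mul _),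
    integral_const_mul, integral_const_mul, integral_const_mul]
  have t0 := mul_nonpos_of_nonneg_of_nonpos (by linarith : 0 ≤ 1 - a - b) i0
  have t1 := mul_nonpos_of_nonneg_of_nonpos ha i1
  have t2 := mul_nonpos_of_nonneg_of_nonpos hb i2
  linarith

end Optimal

/-! ### The cone of geodesic directions -/

section Geodesic

variable {μ : Measure (Space d)} {ξ ζ : Measure (TBundle d)}

lemma scale_mem_fields (hξ : ξ ∈ fields μ) (r : ℝ) : scale r ξ ∈ fields μ := by
  have h := mem_fields_iff.1 hξ
  have := h.1
  have hf := map_mem_fields (ν := ξ) (π := Prod.fst) (f := fun p => r • p.2)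
    (by fun_prop) (by fun_prop) h.2.1 (h.2.2.1.const_smul r)
  rwa [h.2.2.2] at hf

/-- A field lies in the cone of geodesic directions when the plan `(x, x + ε v)` is optimal for some
step `ε > 0`. -/
lemma mem_geodesicCone_iff : ζ ∈ geodesicCone μ ↔ ζ ∈ fields μ ∧
    ∃ ε : ℝ, 0 < ε ∧ IsOptimalPlan (ζ.map (fun p => (p.1, p.1 + ε • p.2))) := by
  constructor
  · rintro ⟨r, hr, ξ, hξ, hopt, rfl⟩
    refine ⟨scale_mem_fields hξ r, ?_⟩
    rcases hr.eq_or_lt with rfl | hr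
    · refine ⟨1, one_pos, ?_⟩
      rw [scale, Measure.map_map (by fun_prop) (by fun_prop)]
      convert! isOptimalPlan_diag (ν := ξ) (X := Prod.fst) measurable_fst using 3
      simp
    · refine ⟨r⁻¹, inv_pos.2 hr, ?_⟩
      rw [scale, Measure.map_map (by fun_prop) (by fun_prop)]
      convert hopt using 3
      simp [smul_smul, inv_mul_cancel₀ hr.ne']
  · rintro ⟨hζ, ε, hε, hopt⟩
    refine ⟨ε⁻¹, by positivity, scale ε ζ, scale_mem_fields hζ ε, ?_, ?_⟩
    · rw [scale, Measure.map_map (by fun_prop) (by fun_prop)]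
      exact hopt
    · rw [scale, scale, Measure.map_map (by fun_prop) (by fun_prop)]
      simp [Function.comp_def, smul_smul, inv_mul_cancel₀ hε.ne']

lemma isCone_geodesicCone : IsCone (geodesicCone μ) := by
  rintro _ ⟨s, hs, ξ, hξ, hopt, rfl⟩ r hr
  refine ⟨r * s, by positivity, ξ, hξ, hopt, ?_⟩
  rw [scale, scale, Measure.map_map (by fun_prop) (by fun_prop)]
  simp [scale, Function.comp_def, smul_smul]

lemma isHorizontallyConvex_geodesicCone : IsHorizontallyConvex (geodesicCone μ) := by
  intro ξ hξ ζ hζ α hα t ht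
  obtain ⟨hξf, ε₁, hε₁, h₁⟩ := mem_geodesicCone_iff.1 hξ
  obtain ⟨hζf, ε₂, hε₂, h₂⟩ := mem_geodesicCone_iff.1 hζ
  obtain ⟨hp, hα1, hα2, hα3, hα4, hα5⟩ := mem_fieldPlans_iff.1 hα
  refine mem_geodesicCone_iff.2 ⟨interpolation_mem_fields hξf hα t, min ε₁ ε₂,
    lt_min hε₁ hε₂, ?_⟩
  rw [← hα4, Measure.map_map (by fun_prop) (by fun_prop)] at h₁
  rw [← hα5, Measure.map_map (by fun_prop) (by fun_prop)] at h₂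
  set ε := min ε₁ ε₂ with hε
  have hεpos : 0 < ε := lt_min hε₁ hε₂
  have hr1 : ε / ε₁ ≤ 1 := (div_le_one hε₁).2 (min_le_left _ _)
  have hr2 : ε / ε₂ ≤ 1 := (div_le_one hε₂).2 (min_le_right _ _)
  have ht1 : 0 ≤ 1 - t := by linarith [ht.2]
  have ht0 := ht.1
  have := isOptimalPlan_combination (ν := α) (X := Prod.fst) (f := fun p => ε₁ • p.2.1)
    (g := fun p => ε₂ • p.2.2) (by fun_prop) (by fun_prop) (by fun_prop) hα1
    (hα2.const_smul ε₁) (hα3.const_smul ε₂) h₁ h₂ (a := (1 - t) * (ε / ε₁)) (b := t * (ε / ε₂))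
    (by positivity) (by positivity) (by nlinarith)
  rw [Measure.map_map (by fun_prop) (by fun_prop)]
  convert this using 3 with p
  have e1 : (1 - t) * (ε / ε₁) * ε₁ = ε * (1 - t) := by field_simp
  have e2 : t * (ε / ε₂) * ε₂ = ε * t := by field_simp
  simp only [Function.comp_apply, smul_add, smul_smul, e1, e2]

end Geodesic

/-! ### The tangent cone -/

section TanCone

variable {μ : Measure (Space d)} {ξ ζ u : Measure (TBundle d)}

/-- A random field `f` of law `ξ` and a plan between `u` and `ξ` can be realised together: some
extension of the probability space carries a field of law `u` whose `L²` distance to `f` is the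
cost of the plan. -/
lemma exists_glue_fieldPlan {Z : Type*} [MeasurableSpace Z] {ν : Measure Z}
    [IsProbabilityMeasure ν] {π f : Z → Space d} (hπ : Measurable π) (hf : Measurable f)
    {β : Measure (T2Bundle d)} (hβ : β ∈ fieldPlans u (ν.map (fun z => (π z, f z)))) :
    ∃ γ : Measure (Z × T2Bundle d), IsProbabilityMeasure γ ∧ γ.map Prod.fst = ν ∧
      γ.map (fun q => (π q.1, q.2.2.1)) = u ∧ MemLp (fun q => q.2.2.1) 2 γ ∧
      ∫⁻ q, ‖q.2.2.1 - f q.1‖ₑ ^ 2 ∂γ = ∫⁻ p, edist p.2.1 p.2.2 ^ 2 ∂β := by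
  obtain ⟨hp, h1, h2, h3, h4, h5⟩ := mem_fieldPlans_iff.1 hβ
  obtain ⟨γ, hγp, hγ1, hγ2, hae⟩ := exists_glue (α := ν) (β := β)
    (f := fun z => (π z, f z)) (g := fun p => (p.1, p.2.2)) (by fun_prop) (by fun_prop) h5.symm
  refine ⟨γ, hγp, hγ1, ?_, ?_, ?_⟩
  · rw [← h4, ← hγ2, Measure.map_map (by fun_prop) (by fun_prop)]
    refine Measure.map_congr ?_
    filter_upwards [hae] with q hq
    rw [Function.comp_apply, ← (Prod.ext_iff.1 hq).1]
  · rw [← hγ2, memLp_comp_map_iff measurable_snd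
      (f := fun p : T2Bundle d => p.2.1) (by fun_prop)] at h2
    exact h2
  · rw [← hγ2, lintegral_map (by fun_prop) (by fun_prop)]
    refine lintegral_congr_ae ?_
    filter_upwards [hae] with q hq
    rw [edist_eq_enorm_sub, ← (Prod.ext_iff.1 hq).2]

lemma enorm_add_sq_le {E : Type*} [NormedAddCommGroup E] (a b : E) :
    ‖a + b‖ₑ ^ 2 ≤ 2 * (‖a‖ₑ ^ 2 + ‖b‖ₑ ^ 2) := by
  have h1 : ‖a + b‖ ^ 2 ≤ 2 * (‖a‖ ^ 2 + ‖b‖ ^ 2) := by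
    nlinarith [norm_add_le a b, norm_nonneg (a + b), sq_nonneg (‖a‖ - ‖b‖), norm_nonneg a,
      norm_nonneg b]
  have h2 := ENNReal.ofReal_le_ofReal h1
  rw [ENNReal.ofReal_mul zero_le_two, ENNReal.ofReal_add (by positivity) (by positivity),
    ENNReal.ofReal_pow (norm_nonneg _), ENNReal.ofReal_pow (norm_nonneg _),
    ENNReal.ofReal_pow (norm_nonneg _), ofReal_norm, ofReal_norm, ofReal_norm] at h2
  simpa using h2

lemma lintegral_enorm_add_sq_lt {Z E : Type*} [MeasurableSpace Z] {ν : Measure Z}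
    [NormedAddCommGroup E] [MeasurableSpace E] [OpensMeasurableSpace E] {f g : Z → E}
    (hf : Measurable f) {ε : ℝ≥0∞}
    (h1 : ∫⁻ z, ‖f z‖ₑ ^ 2 ∂ν < ε) (h2 : ∫⁻ z, ‖g z‖ₑ ^ 2 ∂ν < ε) :
    ∫⁻ z, ‖f z + g z‖ₑ ^ 2 ∂ν < 4 * ε := by
  calc _ ≤ ∫⁻ z, 2 * (‖f z‖ₑ ^ 2 + ‖g z‖ₑ ^ 2) ∂ν := lintegral_mono fun z => enorm_add_sq_le _ _
    _ = 2 * (∫⁻ z, ‖f z‖ₑ ^ 2 ∂ν + ∫⁻ z, ‖g z‖ₑ ^ 2 ∂ν) := by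
      rw [lintegral_const_mul' _ _ (by simp), lintegral_add_left (by fun_prop)]
    _ < 2 * (ε + ε) := by
      refine ENNReal.mul_lt_mul_right (by simp) (by simp) ?_
      exact ENNReal.add_lt_add h1 h2
    _ = 4 * ε := by ring

/-- A weak form of the triangle inequality for `W_μ`, sufficient for closure arguments. -/
lemma WFiberSq_lt_four_mul {ε : ℝ≥0∞} (h1 : WFiberSq u ζ < ε) (h2 : WFiberSq ζ ξ < ε) :
    WFiberSq u ξ < 4 * ε := by
  obtain ⟨β₁, hβ₁, hc₁⟩ := WFiberSq_lt_iff.1 h1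
  obtain ⟨β₂, hβ₂, hc₂⟩ := WFiberSq_lt_iff.1 h2
  obtain ⟨hp, b1, b2, b3, b4, b5⟩ := mem_fieldPlans_iff.1 hβ₂
  rw [← b4] at hβ₁
  obtain ⟨γ, hγp, hγ1, hγu, hγ2, hγc⟩ := exists_glue_fieldPlan (by fun_prop) (by fun_prop) hβ₁
  have l1 : MemLp (fun q : T2Bundle d × T2Bundle d => q.1.1) 2 γ := by
    rwa [← hγ1, memLp_comp_map_iff measurable_fst measurable_fst.stronglyMeasurable] at b1
  have l3 : MemLp (fun q : T2Bundle d × T2Bundle d => q.1.2.2) 2 γ := by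
    rwa [← hγ1, memLp_comp_map_iff measurable_fst (f := fun p : T2Bundle d => p.2.2)
      (by fun_prop)] at b3
  have eξ : ξ = γ.map (fun q => (q.1.1, q.1.2.2)) := by
    rw [← b5, ← hγ1, Measure.map_map (by fun_prop) (by fun_prop)]
    rfl
  rw [← hγu, eξ]
  refine (WFiberSq_map_le (by fun_prop) (by fun_prop) (by fun_prop) l1 hγ2 l3).trans_lt ?_
  rw [← hγc] at hc₁
  rw [← hγ1, lintegral_map (by fun_prop) (by fun_prop)] at hc₂
  simp_rw [edist_eq_enorm_sub] at hc₂
  have := lintegral_enorm_add_sq_lt (by fun_prop) hc₁ hc₂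
  simpa using this

lemma exists_ne_zero_four_mul_lt (ε : ℝ≥0∞) (hε : ε ≠ 0) : ∃ δ : ℝ≥0∞, δ ≠ 0 ∧ 4 * δ ≤ ε :=
  ⟨ε / 4, by simp [hε], (ENNReal.mul_div_cancel (by simp) (by simp)).le⟩

lemma isClosedFor_WFiber_Tan : IsClosedFor WFiber μ (Tan μ) := by
  rw [isClosedFor_WFiber_iff]
  refine fun ξ hξ happ => mem_Tan_iff.2 ⟨hξ, fun ε hε => ?_⟩
  obtain ⟨δ, hδ, hδε⟩ := exists_ne_zero_four_mul_lt ε hε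
  obtain ⟨ζ, hζ, hζξ⟩ := happ δ hδ
  obtain ⟨u, hu, huζ⟩ := (mem_Tan_iff.1 hζ).2 δ hδ
  exact ⟨u, hu, (WFiberSq_lt_four_mul huζ hζξ).trans_le hδε⟩

lemma isCone_Tan : IsCone (Tan μ) := by
  intro ξ hξ r hr
  refine mem_Tan_iff.2 ⟨scale_mem_fields hξ.1 r, fun ε hε => ?_⟩
  have hr0 : ENNReal.ofReal r ^ 2 ≠ ⊤ := by finiteness
  obtain ⟨u, hu, huξ⟩ := (mem_Tan_iff.1 hξ).2 (ε / (ENNReal.ofReal r ^ 2 + 1))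
    (ENNReal.div_ne_zero.2 ⟨hε, by finiteness⟩)
  obtain ⟨β, hβ, hc⟩ := WFiberSq_lt_iff.1 huξ
  obtain ⟨hp, b1, b2, b3, b4, b5⟩ := mem_fieldPlans_iff.1 hβ
  refine ⟨scale r u, isCone_geodesicCone u hu r hr, ?_⟩
  have e1 : scale r u = β.map (fun p => (p.1, r • p.2.1)) := by
    rw [← b4, scale, Measure.map_map (by fun_prop) (by fun_prop)]
    rfl
  have e2 : scale r ξ = β.map (fun p => (p.1, r • p.2.2)) := by
    rw [← b5, scale, Measure.map_map (by fun_prop) (by fun_prop)]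
    rfl
  rw [e1, e2]
  refine (WFiberSq_map_le (by fun_prop) (by fun_prop) (by fun_prop) b1 (b2.const_smul r)
    (b3.const_smul r)).trans_lt ?_
  have e3 : ∀ p : T2Bundle d, ‖r • p.2.1 - r • p.2.2‖ₑ ^ 2 =
      ENNReal.ofReal r ^ 2 * edist p.2.1 p.2.2 ^ 2 := by
    intro p
    rw [← smul_sub, enorm_smul, mul_pow, edist_eq_enorm_sub, Real.enorm_of_nonneg hr]
  refine (lintegral_congr e3).trans_lt ?_
  rw [lintegral_const_mul' _ _ hr0]
  calc _ ≤ (ENNReal.ofReal r ^ 2 + 1) * ∫⁻ p, edist p.2.1 p.2.2 ^ 2 ∂β := by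
        gcongr; exact le_self_add
    _ < (ENNReal.ofReal r ^ 2 + 1) * (ε / (ENNReal.ofReal r ^ 2 + 1)) :=
        ENNReal.mul_lt_mul_right (by simp) (by finiteness) hc
    _ = ε := ENNReal.mul_div_cancel (by simp) (by finiteness)

lemma enorm_smul_sq_le {E : Type*} [NormedAddCommGroup E] [NormedSpace ℝ E] {t : ℝ}
    (ht : t ∈ Set.Icc (0 : ℝ) 1) (a : E) : ‖t • a‖ₑ ^ 2 ≤ ‖a‖ₑ ^ 2 := by
  rw [enorm_smul, Real.enorm_of_nonneg ht.1]
  gcongr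
  exact mul_le_of_le_one_left zero_le (ENNReal.ofReal_le_one.2 ht.2)

lemma isHorizontallyConvex_Tan : IsHorizontallyConvex (Tan μ) := by
  intro ξ hξ ζ hζ α hα t ht
  refine mem_Tan_iff.2 ⟨interpolation_mem_fields hξ.1 hα t, fun ε hε => ?_⟩
  obtain ⟨δ, hδ, hδε⟩ := exists_ne_zero_four_mul_lt ε hε
  obtain ⟨u, hu, huξ⟩ := (mem_Tan_iff.1 hξ).2 δ hδ
  obtain ⟨v, hv, hvζ⟩ := (mem_Tan_iff.1 hζ).2 δ hδ
  obtain ⟨β₁, hβ₁, hc₁⟩ := WFiberSq_lt_iff.1 huξ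
  obtain ⟨β₂, hβ₂, hc₂⟩ := WFiberSq_lt_iff.1 hvζ
  obtain ⟨hp, a1, a2, a3, a4, a5⟩ := mem_fieldPlans_iff.1 hα
  rw [← a4] at hβ₁
  obtain ⟨γ₁, hp1, hγ1, hγ1u, hγ12, hγ1c⟩ := exists_glue_fieldPlan (by fun_prop) (by fun_prop) hβ₁
  have hζ' : ζ = γ₁.map (fun q => (q.1.1, q.1.2.2)) := by
    rw [← a5, ← hγ1, Measure.map_map (by fun_prop) (by fun_prop)]
    rfl
  rw [hζ'] at hβ₂
  obtain ⟨γ, hp2, hγ2, hγv, hγ22, hγc⟩ := exists_glue_fieldPlan (by fun_prop) (by fun_prop) hβ₂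
  have hlift1 : ∀ f : T2Bundle d → Space d, Measurable f → MemLp f 2 α →
      MemLp (fun q : (T2Bundle d × T2Bundle d) × T2Bundle d => f q.1.1) 2 γ := by
    intro f hf hf2
    rw [← hγ1, memLp_comp_map_iff measurable_fst hf.stronglyMeasurable, ← hγ2,
      memLp_comp_map_iff measurable_fst (f := fun q : T2Bundle d × T2Bundle d => f q.1)
        (hf.comp measurable_fst).stronglyMeasurable] at hf2
    exact hf2
  have l1 := hlift1 _ (by fun_prop) a1
  have l2 := hlift1 _ (by fun_prop) a2
  have l3 := hlift1 _ (by fun_prop) a3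
  have l4 : MemLp (fun q : (T2Bundle d × T2Bundle d) × T2Bundle d => q.1.2.2.1) 2 γ := by
    rwa [← hγ2, memLp_comp_map_iff measurable_fst
      (f := fun q : T2Bundle d × T2Bundle d => q.2.2.1) (by fun_prop)] at hγ12
  rw [← hγ1c, ← hγ2, lintegral_map (by fun_prop) (by fun_prop)] at hc₁
  rw [← hγc] at hc₂
  have hu' : γ.map (fun q => (q.1.1.1, q.1.2.2.1)) ∈ geodesicCone μ := by
    rw [← hγ1u, ← hγ2, Measure.map_map (by fun_prop) (by fun_prop)] at hu
    exact hu
  rw [← hγv] at hv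
  refine ⟨_, isHorizontallyConvex_geodesicCone.map_mem (by fun_prop) (by fun_prop) (by fun_prop)
    l1 l4 hγ22 hu' hv ht, ?_⟩
  have e : α.map (fun p => (p.1, (1 - t) • p.2.1 + t • p.2.2)) =
      γ.map (fun q => (q.1.1.1, (1 - t) • q.1.1.2.1 + t • q.1.1.2.2)) := by
    rw [← hγ1, ← hγ2, Measure.map_map (by fun_prop) (by fun_prop),
      Measure.map_map (by fun_prop) (by fun_prop)]
    rfl
  rw [e]
  refine (WFiberSq_map_le (by fun_prop) (by fun_prop) (by fun_prop) l1
    ((l4.const_smul (1 - t)).add (hγ22.const_smul t))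
    ((l2.const_smul (1 - t)).add (l3.const_smul t))).trans_lt (lt_of_lt_of_le ?_ hδε)
  have ht' : 1 - t ∈ Set.Icc (0 : ℝ) 1 := ⟨by linarith [ht.2], by linarith [ht.1]⟩
  have := lintegral_enorm_add_sq_lt
    (f := fun q : (T2Bundle d × T2Bundle d) × T2Bundle d => (1 - t) • (q.1.2.2.1 - q.1.1.2.1))
    (g := fun q => t • (q.2.2.1 - q.1.1.2.2)) (by fun_prop)
    ((lintegral_mono fun q => enorm_smul_sq_le ht' _).trans_lt hc₁)
    ((lintegral_mono fun q => enorm_smul_sq_le ht _).trans_lt hc₂)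
  refine lt_of_eq_of_lt (lintegral_congr fun q => ?_) this
  have e2 : (1 - t) • q.1.2.2.1 + t • q.2.2.1 - ((1 - t) • q.1.1.2.1 + t • q.1.1.2.2) =
      (1 - t) • (q.1.2.2.1 - q.1.1.2.1) + t • (q.2.2.1 - q.1.1.2.2) := by module
  rw [← e2]
  rfl

lemma isClosedConvexCentredCone_Tan0 : IsClosedConvexCentredCone μ (Tan0 μ) where
  centred := Set.inter_subset_right
  closed := fun u hu ξ hξ hlim => ⟨isClosedFor_WFiber_Tan u (fun n => (hu n).1) ξ hξ hlim,
    isClosedFor_WFiber_of_WTangent isClosedFor_WTangent_centredFields u (fun n => (hu n).2) ξ hξ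
      hlim⟩
  convex := fun ξ hξ ζ hζ α hα t ht => ⟨isHorizontallyConvex_Tan ξ hξ.1 ζ hζ.1 α hα t ht,
    isHorizontallyConvex_centredFields ξ hξ.2 ζ hζ.2 α hα t ht⟩
  cone := fun ξ hξ r hr => ⟨isCone_Tan ξ hξ.1 r hr, isCone_centredFields ξ hξ.2 r hr⟩

end TanCone

/-! ### The solenoidal cone -/

section SolCone

variable {μ : Measure (Space d)} {ξ ζ : Measure (TBundle d)}

lemma lintegral_edist_fieldPlan {α : Measure (T2Bundle d)} (hα : α ∈ fieldPlans ξ ζ) :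
    ∫⁻ p, edist p.2.1 p.2.2 ^ 2 ∂α =
      ENNReal.ofReal (normSq ξ + normSq ζ - 2 * ∫ p, inner ℝ p.2.1 p.2.2 ∂α) ∧
    0 ≤ normSq ξ + normSq ζ - 2 * ∫ p, inner ℝ p.2.1 p.2.2 ∂α := by
  obtain ⟨hp, h1, h2, h3, h4, h5⟩ := mem_fieldPlans_iff.1 hα
  have l := lintegral_enorm_sq_eq (h2.sub h3)
  simp only [Pi.sub_apply] at l
  have e : normSq ξ + normSq ζ - 2 * ∫ p, inner ℝ p.2.1 p.2.2 ∂α =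
      ∫ p, ‖p.2.1 - p.2.2‖ ^ 2 ∂α := by
    rw [integral_norm_sub_sq h2 h3, normSq, normSq, ← h4, ← h5,
      integral_map (by fun_prop) (by fun_prop), integral_map (by fun_prop) (by fun_prop)]
    ring
  rw [e]
  simp_rw [edist_eq_enorm_sub]
  exact ⟨l, integral_nonneg fun p => by positivity⟩

lemma metricInner_nonpos_iff (hne : (fieldPlans ξ ζ).Nonempty) :
    metricInner ξ ζ ≤ 0 ↔ ∀ α ∈ fieldPlans ξ ζ, ∫ p, inner ℝ p.2.1 p.2.2 ∂α ≤ 0 := by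
  have htop : WFiberSq ξ ζ ≠ ⊤ := by
    obtain ⟨α, hα⟩ := hne
    refine ne_top_of_le_ne_top ?_ (iInf₂_le α hα)
    rw [(lintegral_edist_fieldPlan hα).1]
    exact ENNReal.ofReal_ne_top
  have h1 : metricInner ξ ζ ≤ 0 ↔ ENNReal.ofReal (normSq ξ + normSq ζ) ≤ WFiberSq ξ ζ := by
    rw [ENNReal.ofReal_le_iff_le_toReal htop, metricInner]
    constructor <;> intro h <;> linarith
  rw [h1, WFiberSq, le_iInf₂_iff]
  refine forall₂_congr fun α hα => ?_
  obtain ⟨e, h0⟩ := lintegral_edist_fieldPlan hα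
  rw [e, ENNReal.ofReal_le_ofReal_iff h0]
  constructor <;> intro h <;> linarith

lemma metricInner_nonneg_of_plan {α : Measure (T2Bundle d)} (hα : α ∈ fieldPlans ξ ζ)
    (h0 : ∫ p, inner ℝ p.2.1 p.2.2 ∂α = 0) : 0 ≤ metricInner ξ ζ := by
  obtain ⟨e, hn⟩ := lintegral_edist_fieldPlan hα
  have h1 : WFiberSq ξ ζ ≤ ENNReal.ofReal (normSq ξ + normSq ζ - 2 * 0) := by
    rw [← h0, ← e]
    exact iInf₂_le α hα
  rw [h0] at hn
  have h2 := ENNReal.toReal_le_of_le_ofReal hn h1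
  rw [metricInner]
  linarith

/-- When `ζ` is centred, the plan that couples `ξ` and `ζ` independently over each base point has
zero correlation. -/
lemma exists_plan_integral_inner_eq_zero (hξ : ξ ∈ fields μ) (hζ : ζ ∈ centredFields μ) :
    ∃ α ∈ fieldPlans ξ ζ, ∫ p, inner ℝ p.2.1 p.2.2 ∂α = 0 := by
  have := isProbabilityMeasure_of_mem_fields hξ
  obtain ⟨κ, hκ, rfl⟩ := exists_kernel_of_mem_fields hξ
  obtain ⟨η, hη, rfl⟩ := exists_kernel_of_mem_fields hζ.1
  obtain ⟨-, h1, h2, -⟩ := mem_fields_iff.1 hξ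
  obtain ⟨-, -, h3, -⟩ := mem_fields_iff.1 hζ.1
  have h0 := (compProd_mem_centredFields_iff.1 hζ).2
  have e1 := map_fst_compProd_prod (ν := μ) κ η
  have e2 := map_snd_compProd_prod (ν := μ) κ η
  rw [← e1, memLp_comp_map_iff (by fun_prop) (by fun_prop)] at h1 h2
  rw [← e2, memLp_comp_map_iff (by fun_prop) (by fun_prop)] at h3
  refine ⟨μ ⊗ₘ (κ ×ₖ η), mem_fieldPlans_iff.2 ⟨inferInstance, h1, h2, h3, e1, e2⟩, ?_⟩
  have hi := integrable_inner_of_memLp h2 h3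
  rw [Measure.integral_compProd hi]
  refine integral_eq_zero_of_ae ?_
  have h3' := (mem_fields_iff.1 hζ.1).2.2.1
  filter_upwards [h0, ae_memLp_of_compProd h3', ((Measure.integrable_compProd_iff hi.1).1 hi).1]
    with x hx hx3 hxi
  simp only [Kernel.prod_apply] at hxi ⊢
  rw [integral_prod _ hxi]
  refine integral_eq_zero_of_ae (ae_of_all _ fun v => ?_)
  have hi' : Integrable (fun w => w) (η x) := hx3.integrable one_le_two
  simp only
  rw [integral_inner hi', hx, inner_zero_right, Pi.zero_apply]

/-- For centred `ζ` the inequality `⟨ξ, ζ⟩_μ ≥ 0` is automatic, so orthogonality to `Tan μ` is the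
system of inequalities `∫ ⟪v, w⟫ dα ≤ 0`. -/
lemma mem_Sol0_iff : ζ ∈ Sol0 μ ↔ ζ ∈ centredFields μ ∧ ∀ ξ ∈ Tan μ, ∀ α ∈ fieldPlans ξ ζ,
    ∫ p, inner ℝ p.2.1 p.2.2 ∂α ≤ 0 := by
  constructor
  · rintro ⟨⟨-, h⟩, hζ⟩
    refine ⟨hζ, fun ξ hξ α hα => ?_⟩
    exact (metricInner_nonpos_iff ⟨α, hα⟩).1 (h ξ hξ).le α hα
  · rintro ⟨hζ, h⟩
    refine ⟨⟨hζ.1, fun ξ hξ => ?_⟩, hζ⟩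
    obtain ⟨α, hα, h0⟩ := exists_plan_integral_inner_eq_zero hξ.1 hζ
    exact le_antisymm ((metricInner_nonpos_iff ⟨α, hα⟩).2 (h ξ hξ))
      (metricInner_nonneg_of_plan hα h0)

lemma isCone_Sol0 : IsCone (Sol0 μ) := by
  intro ζ hζ r hr
  obtain ⟨hζc, hζT⟩ := mem_Sol0_iff.1 hζ
  refine mem_Sol0_iff.2 ⟨isCone_centredFields ζ hζc r hr, fun ξ hξ α hα => ?_⟩
  obtain ⟨hp, a1, a2, a3, a4, a5⟩ := mem_fieldPlans_iff.1 hα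
  obtain ⟨hpζ, -, hζ2, -⟩ := mem_fields_iff.1 hζc.1
  obtain ⟨γ, hγp, hγ1, hγ2, hae⟩ := exists_glue (α := α) (β := ζ)
    (f := fun p => (p.1, p.2.2)) (g := fun p => (p.1, r • p.2)) (by fun_prop) (by fun_prop) a5
  have l1 : MemLp (fun q : T2Bundle d × TBundle d => q.1.1) 2 γ := by
    rwa [← hγ1, memLp_comp_map_iff measurable_fst (by fun_prop)] at a1
  have l2 : MemLp (fun q : T2Bundle d × TBundle d => q.1.2.1) 2 γ := by
    rwa [← hγ1, memLp_comp_map_iff measurable_fst (f := fun p : T2Bundle d => p.2.1)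
      (by fun_prop)] at a2
  have l3 : MemLp (fun q : T2Bundle d × TBundle d => q.2.2) 2 γ := by
    rwa [← hγ2, memLp_comp_map_iff measurable_snd (by fun_prop)] at hζ2
  have hplan := map_mem_fieldPlans (ν := γ) (π := fun q => q.1.1) (f := fun q => q.1.2.1)
    (g := fun q => q.2.2) (by fun_prop) (by fun_prop) (by fun_prop) l1 l2 l3
  have eξ : γ.map (fun q => (q.1.1, q.1.2.1)) = ξ := by
    rw [← a4, ← hγ1, Measure.map_map (by fun_prop) (by fun_prop)]
    rfl
  have eζ : γ.map (fun q => (q.1.1, q.2.2)) = ζ := by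
    have : ζ = γ.map Prod.snd := hγ2.symm
    rw [this]
    refine Measure.map_congr ?_
    filter_upwards [hae] with q hq
    rw [(Prod.ext_iff.1 hq).1]
  rw [eξ, eζ] at hplan
  have hle := hζT ξ hξ _ hplan
  rw [integral_map (by fun_prop) (by fun_prop)] at hle
  rw [← hγ1, integral_map (by fun_prop) (by fun_prop)]
  have e : ∫ q, inner ℝ q.1.2.1 q.1.2.2 ∂γ = r * ∫ q, inner ℝ q.1.2.1 q.2.2 ∂γ := by
    rw [← integral_const_mul]
    refine integral_congr_ae ?_
    filter_upwards [hae] with q hq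
    rw [(Prod.ext_iff.1 hq).2, inner_smul_right]
  rw [e]
  exact mul_nonpos_of_nonneg_of_nonpos hr hle

lemma isHorizontallyConvex_Sol0 : IsHorizontallyConvex (Sol0 μ) := by
  intro ζ₁ hζ₁ ζ₂ hζ₂ α hα t ht
  obtain ⟨hc₁, hT₁⟩ := mem_Sol0_iff.1 hζ₁
  obtain ⟨hc₂, hT₂⟩ := mem_Sol0_iff.1 hζ₂
  refine mem_Sol0_iff.2 ⟨isHorizontallyConvex_centredFields ζ₁ hc₁ ζ₂ hc₂ α hα t ht,
    fun ξ hξ β hβ => ?_⟩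
  obtain ⟨hp, a1, a2, a3, a4, a5⟩ := mem_fieldPlans_iff.1 hα
  obtain ⟨hpβ, b1, b2, b3, b4, b5⟩ := mem_fieldPlans_iff.1 hβ
  obtain ⟨γ, hγp, hγ1, hγ2, hae⟩ := exists_glue (α := β) (β := α)
    (f := fun p => (p.1, p.2.2)) (g := fun p => (p.1, (1 - t) • p.2.1 + t • p.2.2))
    (by fun_prop) (by fun_prop) b5
  have l1 : MemLp (fun q : T2Bundle d × T2Bundle d => q.1.1) 2 γ := by
    rwa [← hγ1, memLp_comp_map_iff measurable_fst (by fun_prop)] at b1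
  have l2 : MemLp (fun q : T2Bundle d × T2Bundle d => q.1.2.1) 2 γ := by
    rwa [← hγ1, memLp_comp_map_iff measurable_fst (f := fun p : T2Bundle d => p.2.1)
      (by fun_prop)] at b2
  have l3 : MemLp (fun q : T2Bundle d × T2Bundle d => q.2.2.1) 2 γ := by
    rwa [← hγ2, memLp_comp_map_iff measurable_snd (f := fun p : T2Bundle d => p.2.1)
      (by fun_prop)] at a2
  have l4 : MemLp (fun q : T2Bundle d × T2Bundle d => q.2.2.2) 2 γ := by
    rwa [← hγ2, memLp_comp_map_iff measurable_snd (f := fun p : T2Bundle d => p.2.2)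
      (by fun_prop)] at a3
  have eξ : γ.map (fun q => (q.1.1, q.1.2.1)) = ξ := by
    rw [← b4, ← hγ1, Measure.map_map (by fun_prop) (by fun_prop)]
    rfl
  have eζ : ∀ f : T2Bundle d → Space d, Measurable f →
      γ.map (fun q => (q.1.1, f q.2)) = α.map (fun p => (p.1, f p)) := by
    intro f hf
    rw [← hγ2, Measure.map_map (by fun_prop) (by fun_prop)]
    refine Measure.map_congr ?_
    filter_upwards [hae] with q hq
    rw [Function.comp_apply, (Prod.ext_iff.1 hq).1]
  have p1 := map_mem_fieldPlans (ν := γ) (π := fun q => q.1.1) (f := fun q => q.1.2.1)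
    (g := fun q => q.2.2.1) (by fun_prop) (by fun_prop) (by fun_prop) l1 l2 l3
  have p2 := map_mem_fieldPlans (ν := γ) (π := fun q => q.1.1) (f := fun q => q.1.2.1)
    (g := fun q => q.2.2.2) (by fun_prop) (by fun_prop) (by fun_prop) l1 l2 l4
  rw [eξ, eζ (fun p => p.2.1) (by fun_prop), a4] at p1
  rw [eξ, eζ (fun p => p.2.2) (by fun_prop), a5] at p2
  have h1 := hT₁ ξ hξ _ p1
  have h2 := hT₂ ξ hξ _ p2
  rw [integral_map (by fun_prop) (by fun_prop)] at h1 h2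
  rw [← hγ1, integral_map (by fun_prop) (by fun_prop)]
  have e : ∫ q, inner ℝ q.1.2.1 q.1.2.2 ∂γ = (1 - t) * ∫ q, inner ℝ q.1.2.1 q.2.2.1 ∂γ +
      t * ∫ q, inner ℝ q.1.2.1 q.2.2.2 ∂γ := by
    rw [← integral_const_mul, ← integral_const_mul,
      ← integral_add ((integrable_inner_of_memLp l2 l3).const_mul _)
        ((integrable_inner_of_memLp l2 l4).const_mul _)]
    refine integral_congr_ae ?_
    filter_upwards [hae] with q hq
    rw [(Prod.ext_iff.1 hq).2, inner_add_right, inner_smul_right, inner_smul_right]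
  rw [e]
  have t1 := mul_nonpos_of_nonneg_of_nonpos (by linarith [ht.2] : 0 ≤ 1 - t) h1
  have t2 := mul_nonpos_of_nonneg_of_nonpos ht.1 h2
  linarith

lemma isClosedFor_WFiber_Sol0 : IsClosedFor WFiber μ (Sol0 μ) := by
  have hcl := isClosedFor_WFiber_of_WTangent (isClosedFor_WTangent_centredFields (μ := μ))
  rw [isClosedFor_WFiber_iff] at hcl ⊢
  intro ζ hζ happ
  refine mem_Sol0_iff.2 ⟨hcl ζ hζ fun ε hε => ?_, fun ξ hξ α hα => ?_⟩
  · obtain ⟨u, hu, h⟩ := happ ε hε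
    exact ⟨u, hu.2, h⟩
  obtain ⟨hp, a1, a2, a3, a4, a5⟩ := mem_fieldPlans_iff.1 hα
  rw [← ENNReal.ofReal_eq_zero]
  refine ennreal_eq_zero_of_forall_le_mul a2.2.ne fun δ hδ _ => ?_
  obtain ⟨u, hu, hlt⟩ := happ (δ ^ 2) (by simpa using hδ)
  obtain ⟨β, hβ, hc⟩ := WFiberSq_lt_iff.1 hlt
  rw [← a5] at hβ
  obtain ⟨γ, hγp, hγ1, hγu, hγ2, hγc⟩ := exists_glue_fieldPlan (by fun_prop) (by fun_prop) hβ
  have l1 : MemLp (fun q : T2Bundle d × T2Bundle d => q.1.1) 2 γ := by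
    rwa [← hγ1, memLp_comp_map_iff measurable_fst (by fun_prop)] at a1
  have l2 : MemLp (fun q : T2Bundle d × T2Bundle d => q.1.2.1) 2 γ := by
    rwa [← hγ1, memLp_comp_map_iff measurable_fst (f := fun p : T2Bundle d => p.2.1)
      (by fun_prop)] at a2
  have l3 : MemLp (fun q : T2Bundle d × T2Bundle d => q.1.2.2) 2 γ := by
    rwa [← hγ1, memLp_comp_map_iff measurable_fst (f := fun p : T2Bundle d => p.2.2)
      (by fun_prop)] at a3
  have eξ : γ.map (fun q => (q.1.1, q.1.2.1)) = ξ := by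
    rw [← a4, ← hγ1, Measure.map_map (by fun_prop) (by fun_prop)]
    rfl
  have hplan := map_mem_fieldPlans (ν := γ) (π := fun q => q.1.1) (f := fun q => q.1.2.1)
    (g := fun q => q.2.2.1) (by fun_prop) (by fun_prop) (by fun_prop) l1 l2 hγ2
  rw [eξ, hγu] at hplan
  have hle := (mem_Sol0_iff.1 hu).2 ξ hξ _ hplan
  rw [integral_map (by fun_prop) (by fun_prop)] at hle
  have hδ' : eLpNorm (fun q : T2Bundle d × T2Bundle d => q.2.2.1 - q.1.2.2) 2 γ ≤ δ := by
    rw [← ENNReal.pow_le_pow_left_iff two_ne_zero, eLpNorm_two_sq, hγc]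
    exact hc.le
  have hS : eLpNorm (fun q : T2Bundle d × T2Bundle d => q.1.2.1) 2 γ =
      eLpNorm (fun p : T2Bundle d => p.2.1) 2 α := by
    rw [← hγ1, eLpNorm_map_measure (by fun_prop) (by fun_prop)]
    rfl
  have e : ∫ p, inner ℝ p.2.1 p.2.2 ∂α = ∫ q, inner ℝ q.1.2.1 q.2.2.1 ∂γ -
      ∫ q, inner ℝ q.1.2.1 (q.2.2.1 - q.1.2.2) ∂γ := by
    simp_rw [inner_sub_right]
    rw [integral_sub (integrable_inner_of_memLp l2 hγ2) (integrable_inner_of_memLp l2 l3),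
      sub_sub_cancel, ← hγ1, integral_map (by fun_prop) (by fun_prop)]
  have hle2 : ∫ p, inner ℝ p.2.1 p.2.2 ∂α ≤
      ‖∫ q, inner ℝ q.1.2.1 (q.2.2.1 - q.1.2.2) ∂γ‖ := by
    rw [e]
    linarith [neg_le_abs (∫ q, inner ℝ q.1.2.1 (q.2.2.1 - q.1.2.2) ∂γ),
      Real.norm_eq_abs (∫ q, inner ℝ q.1.2.1 (q.2.2.1 - q.1.2.2) ∂γ)]
  calc _ ≤ ‖∫ q, inner ℝ q.1.2.1 (q.2.2.1 - q.1.2.2) ∂γ‖ₑ := by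
        rw [← ofReal_norm]
        exact ENNReal.ofReal_le_ofReal hle2
    _ ≤ ∫⁻ q, ‖q.1.2.1‖ₑ * ‖q.2.2.1 - q.1.2.2‖ₑ ∂γ :=
        (enorm_integral_le_lintegral_enorm _).trans
          (lintegral_mono fun q => enorm_inner_le_mul _ _)
    _ ≤ _ := by
        refine (lintegral_enorm_mul_le (by fun_prop) (by fun_prop)).trans ?_
        rw [hS]
        gcongr

lemma isClosedConvexCentredCone_Sol0 : IsClosedConvexCentredCone μ (Sol0 μ) where
  centred := Set.inter_subset_right
  closed := isClosedFor_WFiber_Sol0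
  convex := isHorizontallyConvex_Sol0
  cone := isCone_Sol0

end SolCone

end MeasureField

end

theorem mainTheorem10 (d : ℕ) (hd : 1 ≤ d) (μ : Measure (MeasureField.Space d))
    (hμ : MeasureField.IsP2 μ) :
    (∀ C : Set (Measure (MeasureField.TBundle d)),
      MeasureField.IsClosedConvexCentredCone μ C →
        MeasureField.IsClosedFor MeasureField.WTangent μ C) ∧
    (MeasureField.IsClosedConvexCentredCone μ (MeasureField.Tan0 μ) ∧
      MeasureField.IsClosedFor MeasureField.WTangent μ (MeasureField.Tan0 μ)) ∧
    (MeasureField.IsClosedConvexCentredCone μ (MeasureField.Sol0 μ) ∧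
      MeasureField.IsClosedFor MeasureField.WTangent μ (MeasureField.Sol0 μ)) :=
  ⟨fun _ hC => MeasureField.isClosedFor_WTangent_of_cone hC,
    ⟨MeasureField.isClosedConvexCentredCone_Tan0,
      MeasureField.isClosedFor_WTangent_of_cone MeasureField.isClosedConvexCentredCone_Tan0⟩,
    MeasureField.isClosedConvexCentredCone_Sol0,
    MeasureField.isClosedFor_WTangent_of_cone MeasureField.isClosedConvexCentredCone_Sol0⟩
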